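/- For a finite set $S \subset \mathbb{R}^d$ let the Rips complex $R(S)$ be the simplicial complex with vertex set $S$ whose faces are the subsets of $S$ of diameter at most $1$ (Euclidean distance). For a field $\mathbf{k}$ let $\tilde\beta_p(R(S)) = \dim_{\mathbf{k}} \tilde H_p(R(S);\mathbf{k})$ and $$M_{p,d}(n) = \max\{\tilde\beta_p(R(S)) : S \subset \mathbb{R}^d,\ |S| \le n\}.$$ Theorem. There are a constant $C > 0$ and an integer $n_0$, both independent of $\mathbf{k}$, such that $M_{2,5}(n) > C n^{3/2}$ for all $n \ge n_0$. Moreover, the following explicit configuration witnesses such a bound. For $n \ge 1$ let $k$ be the largest integer with $3k^2 \le n$, let $\delta = n^{-1}$, $\epsilon = n^{-3}$, and let $U = \{u_{i,j}\}$, $V = \{v_{i,j}\}$, $W = \{w_{i,j}\}$, $1 \le i,j \le k$, where $$u_{i,j} = \left(\tfrac{\sqrt2}{2}\cos(i\delta), \tfrac{\sqrt2}{2}\sin(i\delta), 0, 0, j\epsilon\right),$$ $$v_{i,j} = \left(0, 0, \tfrac{\sqrt2}{2}\cos(i\delta), \tfrac{\sqrt2}{2}\sin(i\delta), j\epsilon\right),$$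 $$w_{i,j} = \left(\tfrac{\sqrt2}{4}\cos(i\delta), \tfrac{\sqrt2}{4}\sin(i\delta), \tfrac{\sqrt2}{4}\cos(j\delta), \tfrac{\sqrt2}{4}\sin(j\delta), \tfrac{\sqrt3}{2}\right),$$ and $S_n = U \cup V \cup W \subset \mathbb{R}^5$. For all sufficiently large $n$: $|S_n| \le n$; for every $w \in W$ the set $M_w$ of the edges $uv$ ($u \in U$, $v \in V$) of the link of $w$ in $R(S_n)$ is an induced matching with $k$ edges in the bipartite graph formed by the edges of $R(S_n)$ between $U$ and $V$ (that is, distinct edges $uv, u'v' \in M_w$ have no common endpoint, and neither $uv'$ nor $u'v$ is an edge of $R(S_n)$); and $M_w \cap M_{w'} = \emptyset$ for distinct $w, w' \in W$. Furthermore, for every field $\mathbf{k}$, $$\tilde\beta_2(R(S_n)) \sim 3^{-3/2}\, n^{3/2} \qquad (n \to \infty).$$ -/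

import Mathlib

open Filter Topology

/-! ### Reduced simplicial homology over a field -/

section Homology

variable {V : Type*}

/-- The module of oriented chains spanned by the faces of `K` with `q` vertices (that is, of
dimension `q - 1`), written as alternating functions on `q`-tuples of vertices: the oriented
simplex `[v₀, …, v_{q-1}]` is the function with value `sign σ` at `(v_{σ 0}, …, v_{σ (q-1)})` and
value `0` at all other tuples. For `q = 0` the empty tuple stands for the empty face, so that the
homology obtained is the reduced one. -/
def orientedChains (𝕜 : Type*) [Field 𝕜] (K : AbstractSimplicialComplex V) (q : ℕ) :
    Submodule 𝕜 ((Fin q → V) → 𝕜) where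
  carrier := {c |
    (∀ v, ¬ Function.Injective v → c v = 0) ∧
    (∀ v, (Set.range v).Nonempty → (Set.finite_range v).toFinset ∉ K → c v = 0) ∧
    (∀ v (σ : Equiv.Perm (Fin q)), c (v ∘ σ) = ((Equiv.Perm.sign σ : ℤ) : 𝕜) * c v)}
  zero_mem' := by simp
  add_mem' := by
    rintro a b ⟨ha, ha', ha''⟩ ⟨hb, hb', hb''⟩
    refine ⟨fun v hv => ?_, fun v hv hv' => ?_, fun v σ => ?_⟩
    · simp [ha v hv, hb v hv]
    · simp [ha' v hv hv', hb' v hv hv']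
    · simp [ha'' v σ, hb'' v σ, mul_add]
  smul_mem' := by
    rintro r a ⟨ha, ha', ha''⟩
    refine ⟨fun v hv => ?_, fun v hv hv' => ?_, fun v σ => ?_⟩
    · simp [ha v hv]
    · simp [ha' v hv hv']
    · simp [ha'' v σ, mul_left_comm]

/-- The boundary operator `∂ [v₀, …, v_q] = ∑ i, (-1) ^ i [v₀, …, v̂ᵢ, …, v_q]`, written on
alternating functions: `(∂ c) (v₁, …, v_q) = ∑ x, c (x, v₁, …, v_q)`. -/
def boundaryMap (𝕜 : Type*) [Field 𝕜] (V : Type*) [Fintype V] (q : ℕ) :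
    ((Fin (q + 1) → V) → 𝕜) →ₗ[𝕜] ((Fin q → V) → 𝕜) where
  toFun c := fun v => ∑ x, c (Fin.cons x v)
  map_add' a b := by ext v; simp [Finset.sum_add_distrib]
  map_smul' r a := by ext v; simp [Finset.mul_sum]

variable [Fintype V]

/-- The `p`-cycles: chains on faces with `p + 1` vertices and with zero boundary. -/
def simplicialCycles (𝕜 : Type*) [Field 𝕜] (K : AbstractSimplicialComplex V) (p : ℕ) :
    Submodule 𝕜 ((Fin (p + 1) → V) → 𝕜) :=
  orientedChains 𝕜 K (p + 1) ⊓ LinearMap.ker (boundaryMap 𝕜 V p)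

/-- The `p`-boundaries: boundaries of chains on faces with `p + 2` vertices. -/
def simplicialBoundaries (𝕜 : Type*) [Field 𝕜] (K : AbstractSimplicialComplex V) (p : ℕ) :
    Submodule 𝕜 ((Fin (p + 1) → V) → 𝕜) :=
  (orientedChains 𝕜 K (p + 2)).map (boundaryMap 𝕜 V (p + 1))

/-- The boundary of an oriented chain is an oriented chain. -/
lemma boundaryMap_mem_orientedChains {𝕜 : Type*} [Field 𝕜] {K : AbstractSimplicialComplex V}
    {q : ℕ} {c : (Fin (q + 1) → V) → 𝕜} (hc : c ∈ orientedChains 𝕜 K (q + 1)) :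
    boundaryMap 𝕜 V q c ∈ orientedChains 𝕜 K q := by
  obtain ⟨h1, h2, h3⟩ := hc
  refine ⟨fun v hv => ?_, fun v hv hv' => ?_, fun v σ => ?_⟩
  · refine Finset.sum_eq_zero fun x _ => h1 _ fun h => hv ?_
    exact (Fin.cons_injective_iff.1 h).2
  · refine Finset.sum_eq_zero fun x _ => h2 _ ⟨x, 0, rfl⟩ fun h => hv' ?_
    refine (K.isRelLowerSet_faces h).2 ?_ ?_
    · intro y hy
      simp only [Set.Finite.mem_toFinset, Set.mem_range] at hy ⊢
      obtain ⟨i, rfl⟩ := hy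
      exact ⟨i.succ, by simp⟩
    · simpa using hv
  · change ∑ x, c (Fin.cons x (v ∘ σ)) = _ * ∑ x, c (Fin.cons x v)
    rw [Finset.mul_sum]
    refine Finset.sum_congr rfl fun x _ => ?_
    have hcomp : (Fin.cons x (v ∘ σ) : Fin (q + 1) → V) =
        (Fin.cons x v : Fin (q + 1) → V) ∘ (Equiv.Perm.decomposeFin.symm (0, σ)) := by
      funext i
      refine Fin.cases ?_ (fun j => ?_) i <;> simp
    rw [hcomp, h3]
    simp

/-- `∂ ∘ ∂ = 0`: every boundary is a cycle. -/
lemma simplicialBoundaries_le_simplicialCycles (𝕜 : Type*) [Field 𝕜]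
    (K : AbstractSimplicialComplex V) (p : ℕ) :
    simplicialBoundaries 𝕜 K p ≤ simplicialCycles 𝕜 K p := by
  rintro _ ⟨c, hc, rfl⟩
  refine ⟨boundaryMap_mem_orientedChains hc, ?_⟩
  obtain ⟨h1, -, h3⟩ := hc
  refine LinearMap.mem_ker.2 ?_
  funext v
  change ∑ y, ∑ x, c (Fin.cons x (Fin.cons y v)) = 0
  rw [← Finset.sum_product']
  refine Finset.sum_involution (fun a _ => (a.2, a.1)) ?_ ?_ (by simp) (by simp)
  · rintro ⟨y, x⟩ -
    have hcomp : (Fin.cons y (Fin.cons x v) : Fin (p + 2) → V) =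
        (Fin.cons x (Fin.cons y v) : Fin (p + 2) → V) ∘ (Equiv.swap 0 1) := by
      funext i
      refine Fin.cases ?_ (fun j => Fin.cases ?_ (fun l => ?_) j) i
      · rw [Function.comp_apply, Equiv.swap_apply_left]; rfl
      · rw [Function.comp_apply, Fin.succ_zero_eq_one, Equiv.swap_apply_right]; rfl
      · rw [Function.comp_apply, Equiv.swap_apply_of_ne_of_ne (Fin.succ_ne_zero _)
          (by rw [← Fin.succ_zero_eq_one]
              exact fun h => Fin.succ_ne_zero _ (Fin.succ_injective _ h))]
        rfl
    dsimp only
    rw [hcomp, h3, Equiv.Perm.sign_swap (by simp)]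
    simp
  · rintro ⟨y, x⟩ - hne heq
    refine hne (h1 _ fun hinj => ?_)
    have hyx : x = y := congrArg Prod.fst heq
    have := @hinj 0 1 (by subst hyx; rfl)
    simp at this

/-- The reduced Betti number: the dimension of the reduced homology space `H̃_p(K; 𝕜)`, the
quotient of the `p`-cycles by the `p`-boundaries. -/
noncomputable def reducedBetti (𝕜 : Type*) [Field 𝕜] (K : AbstractSimplicialComplex V) (p : ℕ) :
    ℕ :=
  Module.finrank 𝕜
    (simplicialCycles 𝕜 K p ⧸
      (simplicialBoundaries 𝕜 K p).submoduleOf (simplicialCycles 𝕜 K p))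

end Homology

/-! ### Rips complexes and their extremal Betti numbers -/

/-- The Rips complex `R(S)` of a finite set `S` in `ℝ^d`: the vertices are the points of `S`, the
faces are the (nonempty) subsets of `S` of diameter at most `1`. -/
def ripsComplex {d : ℕ} (S : Finset (EuclideanSpace ℝ (Fin d))) :
    AbstractSimplicialComplex S where
  faces := {F | F.Nonempty ∧ Metric.diam (F : Set S) ≤ 1}
  isRelLowerSet_faces := by
    rintro F ⟨hF, hd⟩
    refine ⟨hF, fun G hGF hG => ⟨hG, le_trans ?_ hd⟩⟩
    exact Metric.diam_mono (by exact_mod_cast hGF) F.finite_toSet.isBounded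
  singleton_mem v := by simp

/-- The values `β̃_p(R(S))`, where `S` ranges over the sets of at most `n` points in `ℝ^d`. -/
def ripsBettiValues (𝕜 : Type*) [Field 𝕜] (p d n : ℕ) : Set ℕ :=
  {m | ∃ S : Finset (EuclideanSpace ℝ (Fin d)), S.card ≤ n ∧
    m = reducedBetti 𝕜 (ripsComplex S) p}

/-- The extremal Betti number `M_{p,d}(n)`, the maximum of `β̃_p(R(S))` over the sets `S` of at
most `n` points in `ℝ^d`. -/
noncomputable def maxRipsBetti (𝕜 : Type*) [Field 𝕜] (p d n : ℕ) : ℕ :=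
  sSup (ripsBettiValues 𝕜 p d n)

/-- `M_{p,d}(n)` is a maximum: the set of values is nonempty and bounded. -/
lemma isGreatest_maxRipsBetti (𝕜 : Type*) [Field 𝕜] (p d n : ℕ) :
    IsGreatest (ripsBettiValues 𝕜 p d n) (maxRipsBetti 𝕜 p d n) := by
  have hb : BddAbove (ripsBettiValues 𝕜 p d n) := by
    refine ⟨n ^ (p + 1), ?_⟩
    rintro _ ⟨S, hS, rfl⟩
    refine (Submodule.finrank_quotient_le _).trans ((Submodule.finrank_le _).trans ?_)
    rw [Module.finrank_fintype_fun_eq_card]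
    simpa using Nat.pow_le_pow_left hS (p + 1)
  exact ⟨Nat.sSup_mem ⟨_, ∅, by simp, rfl⟩ hb, fun m hm => le_csSup hb hm⟩

/-! ### Links and induced matchings -/

/-- The link of a finite set `F` of vertices in `K`. -/
def faceLink {V : Type*} [DecidableEq V] (K : AbstractSimplicialComplex V) (F : Finset V) :
    PreAbstractSimplicialComplex V where
  faces := {G | G.Nonempty ∧ G ∪ F ∈ K ∧ Disjoint G F}
  isRelLowerSet_faces := by
    rintro G ⟨hG, hGF, hd⟩
    refine ⟨hG, fun H hHG hH => ⟨hH, ?_, hd.mono_left hHG⟩⟩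
    exact (K.isRelLowerSet_faces hGF).2 (Finset.union_subset_union_left hHG)
      (hH.mono Finset.subset_union_left)

/-- `M` is an induced matching in the bipartite graph with adjacency `G` between `A` and `B`: the
elements of `M` are edges, distinct edges in `M` have no common endpoint, and for distinct edges
`uv` and `u'v'` in `M` neither `uv'` nor `u'v` is an edge of `G`. -/
def IsInducedMatching {A B : Type*} (G : A → B → Prop) (M : Set (A × B)) : Prop :=
  (∀ e ∈ M, G e.1 e.2) ∧
  ∀ e ∈ M, ∀ e' ∈ M, e ≠ e' →
    e.1 ≠ e'.1 ∧ e.2 ≠ e'.2 ∧ ¬ G e.1 e'.2 ∧ ¬ G e'.1 e.2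

/-! ### The configuration of three clusters in `ℝ^5` -/

/-- The largest `k` with `3 k² ≤ n`. -/
def clusterSize (n : ℕ) : ℕ := Nat.sqrt (n / 3)

/-- The point `u_{i,j}`, with `δ = 1 / n` and `ε = 1 / n³`. -/
noncomputable def uPoint (n i j : ℕ) : EuclideanSpace ℝ (Fin 5) :=
  !₂[√2 / 2 * Real.cos (i * (1 / (n : ℝ))), √2 / 2 * Real.sin (i * (1 / (n : ℝ))), 0, 0,
    j * (1 / (n : ℝ) ^ 3)]

/-- The point `v_{i,j}`, with `δ = 1 / n` and `ε = 1 / n³`. -/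
noncomputable def vPoint (n i j : ℕ) : EuclideanSpace ℝ (Fin 5) :=
  !₂[0, 0, √2 / 2 * Real.cos (i * (1 / (n : ℝ))), √2 / 2 * Real.sin (i * (1 / (n : ℝ))),
    j * (1 / (n : ℝ) ^ 3)]

/-- The point `w_{i,j}`, with `δ = 1 / n`. -/
noncomputable def wPoint (n i j : ℕ) : EuclideanSpace ℝ (Fin 5) :=
  !₂[√2 / 4 * Real.cos (i * (1 / (n : ℝ))), √2 / 4 * Real.sin (i * (1 / (n : ℝ))),
    √2 / 4 * Real.cos (j * (1 / (n : ℝ))), √2 / 4 * Real.sin (j * (1 / (n : ℝ))), √3 / 2]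

open Classical in
/-- The set of all points `f i j` with `1 ≤ i, j ≤ k`, where `k` is the largest integer with
`3 k² ≤ n`. -/
noncomputable def cluster (n : ℕ) (f : ℕ → ℕ → EuclideanSpace ℝ (Fin 5)) :
    Finset (EuclideanSpace ℝ (Fin 5)) :=
  (Finset.Icc 1 (clusterSize n) ×ˢ Finset.Icc 1 (clusterSize n)).image fun a => f a.1 a.2

/-- The cluster `U`. -/
noncomputable def clusterU (n : ℕ) : Finset (EuclideanSpace ℝ (Fin 5)) := cluster n (uPoint n)

/-- The cluster `V`. -/
noncomputable def clusterV (n : ℕ) : Finset (EuclideanSpace ℝ (Fin 5)) := cluster n (vPoint n)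

/-- The cluster `W`. -/
noncomputable def clusterW (n : ℕ) : Finset (EuclideanSpace ℝ (Fin 5)) := cluster n (wPoint n)

open Classical in
/-- The whole configuration `S = U ∪ V ∪ W`. -/
noncomputable def threeClusters (n : ℕ) : Finset (EuclideanSpace ℝ (Fin 5)) :=
  clusterU n ∪ clusterV n ∪ clusterW n

open Classical in
/-- The bipartite graph of the edges of `R(S)` between `U` and `V`. -/
def crossEdge (n : ℕ) (u v : threeClusters n) : Prop :=
  u.1 ∈ clusterU n ∧ v.1 ∈ clusterV n ∧ {u, v} ∈ ripsComplex (threeClusters n)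

open Classical in
/-- The edges `uv` of the link of `w` in `R(S)` with `u ∈ U` and `v ∈ V`. -/
def linkCrossEdges (n : ℕ) (w : threeClusters n) : Set (threeClusters n × threeClusters n) :=
  {e | e.1.1 ∈ clusterU n ∧ e.2.1 ∈ clusterV n ∧
    {e.1, e.2} ∈ faceLink (ripsComplex (threeClusters n)) {w}}

/-! Adjacency in the configuration is combinatorial. Give the clusters `U`, `V`, `W` the colors 0,
1, 2. A point of color `t` carries a label in `{1, …, k}` for each of the other two colors; points
of different colors `t`, `t'` are within distance 1 exactly when their labels for the third color
agree, and points of one color are always within distance 1. This is the structure `TubeComplex`,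
and `clusterPoint_dist_le_one_iff` provides it once `k ≥ 7`. The matching statements then follow by
comparing labels.

For the homology, call a simplex rainbow if it meets all three clusters. The rainbow triangles
correspond to the `k ^ 3` label vectors, and no tetrahedron contains one (`boundaryMap_triangle`).
The remaining simplices form three clusters, each a simplex, joined by `3 * k` tubes. A tube, given
by a color and a value of its label, is again a simplex and has its two ends in the two other
clusters. This subcomplex therefore behaves like a graph with 3 vertices and `3 * k` edges: it has
no second homology, and at most `3 * k` scalar conditions force a 1-cycle in it to bound. Both facts
are instances of `exists_boundaryMap_eq`, proved by coning inside the tubes and then inside the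
clusters.

Hence a 2-cycle is determined modulo boundaries by its coefficients at the rainbow triangles, which
gives `reducedBetti_le`. A combination of rainbow triangles extends to a cycle as soon as `3 * k`
linear conditions hold, which gives `le_reducedBetti`. So the Betti number lies between `k ^ 3 - 3 *
k` and `k ^ 3`, where `k` is asymptotic to `√(n / 3)`. -/

/-! ### Cones and fillings inside a simplex -/

section Filling

variable {V 𝕜 : Type*} [Field 𝕜] {q : ℕ}

/-- The cone over a chain with apex `x`: the oriented simplex `[v₀, …, v_{q-1}]` is sent to
`[x, v₀, …, v_{q-1}]`. -/
noncomputable def coneChain (x : V) (c : (Fin q → V) → 𝕜) : (Fin (q + 1) → V) → 𝕜 := fun v =>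
  open Classical in
  if h : ∃ p : (Fin q → V) × Equiv.Perm (Fin (q + 1)),
      Function.Injective (Fin.cons x p.1 : Fin (q + 1) → V) ∧
        v = (Fin.cons x p.1 : Fin (q + 1) → V) ∘ p.2 then
    ((Equiv.Perm.sign h.choose.2 : ℤ) : 𝕜) * c h.choose.1
  else 0

/-- The choice in `coneChain` is harmless: two presentations of one injective tuple differ by a
permutation that fixes the position of the apex, and the alternation of `c` absorbs it. -/
lemma coneChain_cons_comp (x : V) {c : (Fin q → V) → 𝕜}
    (hc : ∀ v (σ : Equiv.Perm (Fin q)), c (v ∘ σ) = ((Equiv.Perm.sign σ : ℤ) : 𝕜) * c v)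
    {p : Fin q → V} (hp : Function.Injective (Fin.cons x p : Fin (q + 1) → V))
    (σ : Equiv.Perm (Fin (q + 1))) :
    coneChain x c ((Fin.cons x p : Fin (q + 1) → V) ∘ σ) =
      ((Equiv.Perm.sign σ : ℤ) : 𝕜) * c p := by
  have h : ∃ p' : (Fin q → V) × Equiv.Perm (Fin (q + 1)),
      Function.Injective (Fin.cons x p'.1 : Fin (q + 1) → V) ∧
        (Fin.cons x p : Fin (q + 1) → V) ∘ σ = (Fin.cons x p'.1 : Fin (q + 1) → V) ∘ p'.2 :=
    ⟨(p, σ), hp, rfl⟩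
  rw [coneChain, dif_pos h]
  obtain ⟨-, h2⟩ := h.choose_spec
  generalize h.choose = w at h2
  obtain ⟨p', σ'⟩ := w
  dsimp only at h2 ⊢
  obtain ⟨τ, hτ⟩ : ∃ τ, σ = τ * σ' := ⟨σ * σ'⁻¹, by simp⟩
  subst hτ
  have h3 : (Fin.cons x p : Fin (q + 1) → V) ∘ τ = Fin.cons x p' := by
    funext i
    have := congrFun h2 (σ'⁻¹ i)
    simpa using this
  obtain ⟨⟨a, e⟩, rfl⟩ := Equiv.Perm.decomposeFin.symm.surjective τ
  have ha : a = 0 := by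
    apply hp
    have := congrFun h3 0
    simpa using this
  subst ha
  have h4 : p' = p ∘ e := by
    funext i
    have := congrFun h3 i.succ
    simpa using this.symm
  rw [h4, hc]
  simp
  ring

lemma coneChain_eq_zero {x : V} (c : (Fin q → V) → 𝕜) {v : Fin (q + 1) → V}
    (hv : ¬ (Function.Injective v ∧ x ∈ Set.range v)) : coneChain x c v = 0 := by
  rw [coneChain, dif_neg]
  rintro ⟨⟨p, σ⟩, hp, rfl⟩
  exact hv ⟨hp.comp σ.injective, σ⁻¹ 0, by simp⟩

lemma exists_eq_cons_comp {x : V} {v : Fin (q + 1) → V} (hx : x ∈ Set.range v) :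
    ∃ (p : Fin q → V) (σ : Equiv.Perm (Fin (q + 1))),
      v = (Fin.cons x p : Fin (q + 1) → V) ∘ σ := by
  obtain ⟨i, rfl⟩ := hx
  refine ⟨fun j => v (Equiv.swap 0 i j.succ), Equiv.swap 0 i, ?_⟩
  funext j
  obtain ⟨k, rfl⟩ := (Equiv.swap 0 i).surjective j
  rw [Function.comp_apply, Equiv.swap_apply_self]
  refine Fin.cases ?_ (fun k => ?_) k <;> simp

lemma exists_eq_cons_comp_injective {x : V} {v : Fin (q + 1) → V} (hv : Function.Injective v)
    (hx : x ∈ Set.range v) :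
    ∃ (p : Fin q → V) (σ : Equiv.Perm (Fin (q + 1))),
      v = (Fin.cons x p : Fin (q + 1) → V) ∘ σ ∧
        Function.Injective (Fin.cons x p : Fin (q + 1) → V) := by
  obtain ⟨p, σ, rfl⟩ := exists_eq_cons_comp hx
  refine ⟨p, σ, rfl, ?_⟩
  have := hv.comp σ⁻¹.injective
  simpa [Function.comp_assoc] using this

/-- The restriction of a chain to the tuples with property `P`. -/
noncomputable def restrictChain (𝕜 : Type*) [Field 𝕜] (P : (Fin q → V) → Prop) :
    ((Fin q → V) → 𝕜) →ₗ[𝕜] ((Fin q → V) → 𝕜) where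
  toFun c := fun v => open Classical in if P v then c v else 0
  map_add' a b := by ext v; by_cases h : P v <;> simp [h]
  map_smul' r a := by ext v; by_cases h : P v <;> simp [h]

lemma restrictChain_of_pos {P : (Fin q → V) → Prop} (c : (Fin q → V) → 𝕜) {v : Fin q → V}
    (h : P v) : restrictChain 𝕜 P c v = c v := if_pos h

lemma restrictChain_of_neg {P : (Fin q → V) → Prop} (c : (Fin q → V) → 𝕜) {v : Fin q → V}
    (h : ¬ P v) : restrictChain 𝕜 P c v = 0 := if_neg h

lemma restrictChain_ne_zero {P : (Fin q → V) → Prop} {c : (Fin q → V) → 𝕜} {v : Fin q → V}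
    (h : restrictChain 𝕜 P c v ≠ 0) : P v ∧ c v ≠ 0 := by
  by_cases hP : P v
  · exact ⟨hP, by rwa [restrictChain_of_pos c hP] at h⟩
  · exact absurd (restrictChain_of_neg c hP) h

lemma restrictChain_mem {K : AbstractSimplicialComplex V} {P : (Fin q → V) → Prop}
    (hP : ∀ v (σ : Equiv.Perm (Fin q)), P (v ∘ σ) ↔ P v) {c : (Fin q → V) → 𝕜}
    (hc : c ∈ orientedChains 𝕜 K q) : restrictChain 𝕜 P c ∈ orientedChains 𝕜 K q := by
  obtain ⟨h1, h2, h3⟩ := hc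
  refine ⟨fun v hv => ?_, fun v hv hv' => ?_, fun v σ => ?_⟩
  · by_contra h
    exact (restrictChain_ne_zero h).2 (h1 v hv)
  · by_contra h
    exact (restrictChain_ne_zero h).2 (h2 v hv hv')
  · by_cases h : P v
    · rw [restrictChain_of_pos c h, restrictChain_of_pos c ((hP v σ).2 h), h3]
    · rw [restrictChain_of_neg c h, restrictChain_of_neg c (fun h' => h ((hP v σ).1 h')), mul_zero]

lemma forall_comp_perm (T : V → Prop) (v : Fin q → V) (σ : Equiv.Perm (Fin q)) :
    (∀ i, T ((v ∘ σ) i)) ↔ ∀ i, T (v i) :=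
  ⟨fun h i => by simpa using h (σ⁻¹ i), fun h i => h _⟩

lemma coneChain_mem {K : AbstractSimplicialComplex V} {T : Set V}
    (hT : ∀ F : Finset V, F.Nonempty → (F : Set V) ⊆ T → F ∈ K) {x : V} (hx : x ∈ T)
    {c : (Fin q → V) → 𝕜} (hc : c ∈ orientedChains 𝕜 K q) (hcT : ∀ v, c v ≠ 0 → ∀ i, v i ∈ T) :
    coneChain x c ∈ orientedChains 𝕜 K (q + 1) ∧ ∀ v, coneChain x c v ≠ 0 → ∀ i, v i ∈ T := by
  have hsupp : ∀ v, coneChain x c v ≠ 0 → ∀ i, v i ∈ T := by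
    intro v hv
    by_cases h : Function.Injective v ∧ x ∈ Set.range v
    · obtain ⟨p, σ, rfl, hp⟩ := exists_eq_cons_comp_injective h.1 h.2
      rw [coneChain_cons_comp x hc.2.2 hp] at hv
      have := hcT p (right_ne_zero_of_mul hv)
      refine (forall_comp_perm (· ∈ T) _ σ).2 fun i => ?_
      refine Fin.cases ?_ (fun i => ?_) i
      · simpa
      · simpa using this i
    · exact absurd (coneChain_eq_zero c h) hv
  refine ⟨⟨fun v hv => coneChain_eq_zero c fun h => hv h.1, fun v hv hv' => ?_, fun v σ => ?_⟩,
    hsupp⟩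
  · by_contra h
    refine hv' (hT _ (by simpa using hv) ?_)
    rintro _ hy
    simp only [Set.Finite.coe_toFinset] at hy
    obtain ⟨i, rfl⟩ := hy
    exact hsupp v h i
  · by_cases h : Function.Injective v ∧ x ∈ Set.range v
    · obtain ⟨p, τ, rfl, hp⟩ := exists_eq_cons_comp_injective h.1 h.2
      rw [coneChain_cons_comp x hc.2.2 hp, Function.comp_assoc, ← Equiv.Perm.coe_mul,
        coneChain_cons_comp x hc.2.2 hp]
      simp
      ring
    · rw [coneChain_eq_zero c h, coneChain_eq_zero c, mul_zero]
      rintro ⟨h1, h2⟩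
      refine h ⟨?_, ?_⟩
      · simpa [Function.comp_assoc] using h1.comp σ⁻¹.injective
      · obtain ⟨i, hi⟩ := h2
        exact ⟨σ i, hi⟩

lemma cons_cons_comp_swap {x y : V} (v : Fin q → V) :
    (Fin.cons y (Fin.cons x v) : Fin (q + 2) → V) =
      (Fin.cons x (Fin.cons y v) : Fin (q + 2) → V) ∘ (Equiv.swap 0 1) := by
  funext i
  refine Fin.cases ?_ (fun j => Fin.cases ?_ (fun l => ?_) j) i
  · rw [Function.comp_apply, Equiv.swap_apply_left]; rfl
  · rw [Function.comp_apply, Fin.succ_zero_eq_one, Equiv.swap_apply_right]; rfl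
  · rw [Function.comp_apply, Equiv.swap_apply_of_ne_of_ne (Fin.succ_ne_zero _)
      (by rw [← Fin.succ_zero_eq_one]
          exact fun h => Fin.succ_ne_zero _ (Fin.succ_injective _ h))]
    rfl

variable [Fintype V]

lemma boundaryMap_apply (c : (Fin (q + 1) → V) → 𝕜) (v : Fin q → V) :
    boundaryMap 𝕜 V q c v = ∑ x, c (Fin.cons x v) := rfl

lemma boundaryMap_boundaryMap {K : AbstractSimplicialComplex V} {c : (Fin (q + 2) → V) → 𝕜}
    (hc : c ∈ orientedChains 𝕜 K (q + 2)) :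
    boundaryMap 𝕜 V q (boundaryMap 𝕜 V (q + 1) c) = 0 :=
  (simplicialBoundaries_le_simplicialCycles 𝕜 K q ⟨c, hc, rfl⟩).2

/-- If `c` vanishes off the tuples in `T`, so does its boundary. -/
lemma boundaryMap_support {T : Set V} {c : (Fin (q + 1) → V) → 𝕜}
    (hc : ∀ v, c v ≠ 0 → ∀ i, v i ∈ T) (v : Fin q → V) (hv : boundaryMap 𝕜 V q c v ≠ 0) (i) :
    v i ∈ T := by
  rw [boundaryMap_apply] at hv
  obtain ⟨x, -, hx⟩ := Finset.exists_ne_zero_of_sum_ne_zero hv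
  simpa using hc _ hx i.succ

/-- The cone operator is a chain contraction: on a cycle `c`, `∂ (cone c) = c`. -/
lemma boundaryMap_coneChain {K : AbstractSimplicialComplex V} {c : (Fin (q + 1) → V) → 𝕜}
    (hc : c ∈ orientedChains 𝕜 K (q + 1)) (hcyc : boundaryMap 𝕜 V q c = 0) (x : V)
    (halt : ∀ v (σ : Equiv.Perm (Fin (q + 2))),
      coneChain x c (v ∘ σ) = ((Equiv.Perm.sign σ : ℤ) : 𝕜) * coneChain x c v) :
    boundaryMap 𝕜 V (q + 1) (coneChain x c) = c := by
  classical
  have key : ∀ v : Fin (q + 1) → V, Function.Injective (Fin.cons x v : Fin (q + 2) → V) →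
      coneChain x c (Fin.cons x v) = c v := fun v hv => by
    simpa using coneChain_cons_comp x hc.2.2 hv 1
  funext v
  rw [boundaryMap_apply]
  by_cases hv : Function.Injective v
  swap
  · rw [hc.1 v hv]
    exact Finset.sum_eq_zero fun y _ =>
      coneChain_eq_zero c fun h => hv (Fin.cons_injective_iff.1 h.1).2
  by_cases hx : x ∈ Set.range v
  · obtain ⟨p, σ, rfl, hp⟩ := exists_eq_cons_comp_injective hv hx
    have h1 : ∀ y, (Fin.cons y ((Fin.cons x p : Fin (q + 1) → V) ∘ σ) : Fin (q + 2) → V) =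
        (Fin.cons y (Fin.cons x p) : Fin (q + 2) → V) ∘
          (Equiv.Perm.decomposeFin.symm (0, σ)) := by
      intro y
      funext i
      refine Fin.cases ?_ (fun j => ?_) i <;> simp
    simp only [h1, halt, hc.2.2, Equiv.Perm.decomposeFin.symm_sign]
    rw [← Finset.mul_sum]
    simp only [if_true, one_mul]
    congr 1
    -- Moving `x` to the front costs a sign. The term `y = x` has a repeated vertex and vanishes, so
    -- the sum is minus that of `c (y, p)` over `y ≠ x`, which is `c (x, p)` because `c` is a cycle.
    have h2 : ∀ y, coneChain x c (Fin.cons y (Fin.cons x p)) =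
        - (if y = x then 0 else c (Fin.cons y p)) := by
      intro y
      rw [cons_cons_comp_swap, halt, Equiv.Perm.sign_swap (by simp)]
      by_cases hinj : Function.Injective (Fin.cons x (Fin.cons y p) : Fin (q + 2) → V)
      · rw [key _ hinj, if_neg]
        · simp
        · rintro rfl
          have := @hinj 0 1 rfl
          simp at this
      · rw [coneChain_eq_zero c (fun h => hinj h.1)]
        split_ifs with hyx
        · simp
        · rw [hc.1]
          · simp
          · intro hyp
            refine hinj (Fin.cons_injective_iff.2 ⟨?_, hyp⟩)
            rintro ⟨i, hi⟩
            revert hi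
            refine Fin.cases ?_ (fun j => ?_) i
            · simpa using hyx
            · intro hi
              exact (Fin.cons_injective_iff.1 hp).1 ⟨j, by simpa using hi⟩
    have h3 : ∑ y, c (Fin.cons y p) = 0 := congrFun hcyc p
    simp only [h2, Finset.sum_neg_distrib]
    rw [← Finset.add_sum_erase _ _ (Finset.mem_univ x)] at h3 ⊢
    rw [if_pos rfl, Finset.sum_congr rfl (fun y hy => if_neg (Finset.ne_of_mem_erase hy)),
      eq_neg_of_add_eq_zero_right h3]
    simp
  -- If `v` avoids the apex, only the summand that adds the apex can be nonzero.
  · rw [Finset.sum_eq_single x]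
    · exact key v (Fin.cons_injective_iff.2 ⟨hx, hv⟩)
    · intro y _ hy
      refine coneChain_eq_zero c fun h => ?_
      obtain ⟨i, hi⟩ := h.2
      revert hi
      refine Fin.cases ?_ (fun j => ?_) i
      · simpa using hy
      · intro hi
        exact hx ⟨j, by simpa using hi⟩
    · simp

/-- A cycle supported on a simplex bounds a chain supported on that simplex. -/
lemma exists_boundaryMap_eq_of_simplex {K : AbstractSimplicialComplex V} {T : Set V}
    (hT : ∀ F : Finset V, F.Nonempty → (F : Set V) ⊆ T → F ∈ K) {c : (Fin (q + 1) → V) → 𝕜}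
    (hc : c ∈ orientedChains 𝕜 K (q + 1)) (hcT : ∀ v, c v ≠ 0 → ∀ i, v i ∈ T)
    (hcyc : boundaryMap 𝕜 V q c = 0) :
    ∃ d ∈ orientedChains 𝕜 K (q + 2), (∀ v, d v ≠ 0 → ∀ i, v i ∈ T) ∧
      boundaryMap 𝕜 V (q + 1) d = c := by
  rcases T.eq_empty_or_nonempty with rfl | ⟨x, hx⟩
  · refine ⟨0, zero_mem _, by simp, ?_⟩
    rw [map_zero]
    funext v
    by_contra h
    exact hcT v (Ne.symm h) 0
  · obtain ⟨h1, h2⟩ := coneChain_mem hT hx hc hcT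
    exact ⟨_, h1, h2, boundaryMap_coneChain hc hcyc x h1.2.2⟩

/-- Let `T₁ ∪ T₂` be a simplex. A chain supported on it, whose boundary is the sum of a cycle
supported on `T₁` and a chain supported on `T₂`, is a boundary up to chains supported on `T₁`
and on `T₂`. -/
lemma exists_boundaryMap_eq_of_join {K : AbstractSimplicialComplex V} {T₁ T₂ : Set V}
    (hT : ∀ F : Finset V, F.Nonempty → (F : Set V) ⊆ T₁ ∪ T₂ → F ∈ K) (hdisj : Disjoint T₁ T₂)
    {c : (Fin (q + 2) → V) → 𝕜} (hc : c ∈ orientedChains 𝕜 K (q + 2))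
    (hcT : ∀ v, c v ≠ 0 → ∀ i, v i ∈ T₁ ∪ T₂)
    (hbd : ∀ v, boundaryMap 𝕜 V (q + 1) c v ≠ 0 → (∀ i, v i ∈ T₁) ∨ (∀ i, v i ∈ T₂))
    (hcyc : boundaryMap 𝕜 V q
      (restrictChain 𝕜 (fun v => ∀ i, v i ∈ T₁) (boundaryMap 𝕜 V (q + 1) c)) = 0) :
    ∃ d ∈ orientedChains 𝕜 K (q + 3), (∀ v, d v ≠ 0 → ∀ i, v i ∈ T₁ ∪ T₂) ∧
      ∀ v, c v - boundaryMap 𝕜 V (q + 2) d v ≠ 0 → (∀ i, v i ∈ T₁) ∨ (∀ i, v i ∈ T₂) := by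
  set b := boundaryMap 𝕜 V (q + 1) c with hb
  have hbK : b ∈ orientedChains 𝕜 K (q + 1) := boundaryMap_mem_orientedChains hc
  set p₁ := restrictChain 𝕜 (fun v => ∀ i, v i ∈ T₁) b with hp₁
  set p₂ := restrictChain 𝕜 (fun v => ∀ i, v i ∈ T₂) b with hp₂
  have hsum : b = p₁ + p₂ := by
    funext v
    rw [Pi.add_apply]
    by_cases h1 : ∀ i, v i ∈ T₁
    · have h2 : ¬ ∀ i, v i ∈ T₂ := fun h2 => Set.disjoint_left.1 hdisj (h1 0) (h2 0)
      rw [hp₁, hp₂, restrictChain_of_pos b h1, restrictChain_of_neg b h2, add_zero]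
    · by_cases h2 : ∀ i, v i ∈ T₂
      · rw [hp₁, hp₂, restrictChain_of_neg b h1, restrictChain_of_pos b h2, zero_add]
      · rw [hp₁, hp₂, restrictChain_of_neg b h1, restrictChain_of_neg b h2, add_zero]
        by_contra h
        exact (hbd v h).elim h1 h2
  have hcyc₂ : boundaryMap 𝕜 V q p₂ = 0 := by
    have := boundaryMap_boundaryMap hc
    rwa [← hb, hsum, map_add, hcyc, zero_add] at this
  obtain ⟨P₁, hP₁K, hP₁T, hP₁⟩ := exists_boundaryMap_eq_of_simplex (T := T₁)
    (fun F hF hFT => hT F hF (hFT.trans Set.subset_union_left))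
    (restrictChain_mem (forall_comp_perm (· ∈ T₁)) hbK)
    (fun v hv => (restrictChain_ne_zero hv).1) hcyc
  obtain ⟨P₂, hP₂K, hP₂T, hP₂⟩ := exists_boundaryMap_eq_of_simplex (T := T₂)
    (fun F hF hFT => hT F hF (hFT.trans Set.subset_union_right))
    (restrictChain_mem (forall_comp_perm (· ∈ T₂)) hbK)
    (fun v hv => (restrictChain_ne_zero hv).1) hcyc₂
  -- Subtracting the fillings `P₁`, `P₂` of the two parts of the boundary leaves a cycle in the
  -- whole simplex. Its filling `d` satisfies `c - ∂d = P₁ + P₂`.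
  obtain ⟨d, hdK, hdT, hd⟩ := exists_boundaryMap_eq_of_simplex (c := c - (P₁ + P₂)) hT
    (sub_mem hc (add_mem hP₁K hP₂K))
    (fun v hv i => by
      by_contra h
      refine hv ?_
      have e0 : c v = 0 := by
        by_contra h'
        exact h (hcT v h' i)
      have e1 : P₁ v = 0 := by
        by_contra h'
        exact h (Or.inl (hP₁T v h' i))
      have e2 : P₂ v = 0 := by
        by_contra h'
        exact h (Or.inr (hP₂T v h' i))
      simp [e0, e1, e2])
    (by rw [map_sub, map_add, hP₁, hP₂, ← hb, ← hsum, sub_self])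
  refine ⟨d, hdK, hdT, fun v hv => ?_⟩
  rw [hd] at hv
  by_contra! h
  refine hv ?_
  have e1 : P₁ v = 0 := by
    by_contra h'
    obtain ⟨⟨i, hi⟩, -⟩ := h
    exact hi (hP₁T v h' i)
  have e2 : P₂ v = 0 := by
    by_contra h'
    obtain ⟨-, ⟨i, hi⟩⟩ := h
    exact hi (hP₂T v h' i)
  simp [e1, e2]

end Filling

/-! ### Clusters joined by tubes: filling cycles without rainbow simplices -/

section Tubes

/-- A flag complex on three clusters of vertices, each cluster a simplex. Every vertex has a color
(its cluster) and, for every color `m` other than its own, a label in `Fin k`; vertices of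
different colors are adjacent if and only if their labels for the third color agree. Each vertex is
determined by its color and its labels, and all labels occur. -/
structure TubeComplex {V : Type*} (K : AbstractSimplicialComplex V) (k : ℕ) where
  /-- the cluster of a vertex -/
  color : V → Fin 3
  /-- the labels of a vertex -/
  label : V → Fin 3 → Fin k
  mem_iff : ∀ F : Finset V, F ∈ K ↔ F.Nonempty ∧ ∀ x ∈ F, ∀ y ∈ F,
    color x = color y ∨ ∀ m, m ≠ color x → m ≠ color y → label x m = label y m
  eq_of_label : ∀ x y, color x = color y → (∀ m, m ≠ color x → label x m = label y m) → x = y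
  /-- the vertex of a given color with given labels -/
  pt : Fin 3 → (Fin 3 → Fin k) → V
  color_pt : ∀ t L, color (pt t L) = t
  label_pt : ∀ t L m, m ≠ t → label (pt t L) m = L m

variable {V 𝕜 : Type*} [Field 𝕜] {q k : ℕ} {K : AbstractSimplicialComplex V}

namespace TubeComplex

variable (X : TubeComplex K k)

/-- The tuple `v` meets all three clusters. -/
def Rainbow (v : Fin q → V) : Prop := ∀ t, ∃ i, X.color (v i) = t

/-- The vertices of color `s.1 + 1` with label `s.2` for the color `s.1`. -/
def left (s : Fin 3 × Fin k) : Set V := {x | X.color x = s.1 + 1 ∧ X.label x s.1 = s.2}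

/-- The vertices of color `s.1 + 2` with label `s.2` for the color `s.1`. -/
def right (s : Fin 3 × Fin k) : Set V := {x | X.color x = s.1 + 2 ∧ X.label x s.1 = s.2}

/-- The tuple `v` is contained in the tube `left s ∪ right s` and meets both ends. -/
def Mixed (s : Fin 3 × Fin k) (v : Fin q → V) : Prop :=
  (∀ i, v i ∈ X.left s ∪ X.right s) ∧ (∃ i, v i ∈ X.left s) ∧ ∃ i, v i ∈ X.right s

lemma disjoint_left_right (s : Fin 3 × Fin k) : Disjoint (X.left s) (X.right s) := by
  refine Set.disjoint_left.2 fun x h1 h2 => ?_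
  have := h1.1.symm.trans h2.1
  revert this
  generalize s.1 = m
  revert m
  decide

lemma tube_mem (s : Fin 3 × Fin k) (F : Finset V) (hF : F.Nonempty)
    (h : (F : Set V) ⊆ X.left s ∪ X.right s) : F ∈ K := by
  refine (X.mem_iff F).2 ⟨hF, fun x hx y hy => ?_⟩
  obtain ⟨a, b⟩ := s
  have aux : ∀ a m : Fin 3, m ≠ a + 1 → m ≠ a + 2 → m = a := by decide
  have hx := h hx
  have hy := h hy
  simp only [left, right, Set.mem_union, Set.mem_ofPred_eq] at hx hy
  rcases hx with ⟨h1, h2⟩ | ⟨h1, h2⟩ <;> rcases hy with ⟨h3, h4⟩ | ⟨h3, h4⟩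
  · exact Or.inl (h1.trans h3.symm)
  · refine Or.inr fun m hm hm' => ?_
    rw [h1] at hm
    rw [h3] at hm'
    obtain rfl := aux _ _ hm hm'
    rw [h2, h4]
  · refine Or.inr fun m hm hm' => ?_
    rw [h1] at hm
    rw [h3] at hm'
    obtain rfl := aux _ _ hm' hm
    rw [h2, h4]
  · exact Or.inl (h1.trans h3.symm)

lemma cluster_mem (t : Fin 3) (F : Finset V) (hF : F.Nonempty)
    (h : (F : Set V) ⊆ {x | X.color x = t}) : F ∈ K :=
  (X.mem_iff F).2 ⟨hF, fun _ hx _ hy => Or.inl ((h hx).trans (h hy).symm)⟩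

lemma mixed_comp (s : Fin 3 × Fin k) (v : Fin q → V) (σ : Equiv.Perm (Fin q)) :
    X.Mixed s (v ∘ σ) ↔ X.Mixed s v := by
  unfold Mixed
  rw [forall_comp_perm (· ∈ X.left s ∪ X.right s)]
  refine and_congr_right fun _ => and_congr ?_ ?_ <;>
  exact ⟨fun ⟨i, hi⟩ => ⟨σ i, hi⟩, fun ⟨i, hi⟩ => ⟨σ⁻¹ i, by simpa using hi⟩⟩

/-- In a tuple that is mixed in some tube, the tube is determined. -/
lemma Mixed.unique {X : TubeComplex K k} {s s' : Fin 3 × Fin k} {v : Fin q → V}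
    (h : X.Mixed s v) (h' : X.Mixed s' v) : s = s' := by
  obtain ⟨h0, ⟨i, hi, hi'⟩, ⟨j, hj, hj'⟩⟩ := h
  obtain ⟨g0, -, -⟩ := h'
  obtain ⟨m, l⟩ := s
  obtain ⟨m', l'⟩ := s'
  have gi := g0 i
  have gj := g0 j
  simp only [left, right, Set.mem_union, Set.mem_ofPred_eq] at *
  rw [hi] at gi
  rw [hj] at gj
  have aux : ∀ m m' : Fin 3, (m + 1 = m' + 1 ∨ m + 1 = m' + 2) →
    (m + 2 = m' + 1 ∨ m + 2 = m' + 2) → m = m' := by decide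
  obtain rfl := aux m m' (gi.imp And.left And.left) (gj.imp And.left And.left)
  rw [← hi']
  rcases gi with gi | gi <;> rw [gi.2]

/-- A face that does not meet all three clusters is contained in a cluster or mixed in a tube. -/
lemma exists_mixed {v : Fin q → V}
    (hv : ∀ i j, X.color (v i) = X.color (v j) ∨
      ∀ m, m ≠ X.color (v i) → m ≠ X.color (v j) → X.label (v i) m = X.label (v j) m)
    (hr : ¬ X.Rainbow v) (hc : ¬ ∃ t, ∀ i, X.color (v i) = t) : ∃ s, X.Mixed s v := by
  unfold Rainbow at hr
  push Not at hr
  obtain ⟨m, hm⟩ := hr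
  have aux : ∀ m t : Fin 3, t ≠ m → t = m + 1 ∨ t = m + 2 := by decide
  have aux0 : ∀ m : Fin 3, m ≠ m + 1 ∧ m ≠ m + 2 ∧ m + 1 ≠ m + 2 := by decide
  obtain ⟨a1, a2, a3⟩ := aux0 m
  have hcol := fun i => aux m _ (hm i)
  have h1 : ∃ i, X.color (v i) = m + 1 := by
    by_contra! h
    exact hc ⟨m + 2, fun i => (hcol i).resolve_left (h i)⟩
  have h2 : ∃ i, X.color (v i) = m + 2 := by
    by_contra! h
    exact hc ⟨m + 1, fun i => (hcol i).resolve_right (h i)⟩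
  obtain ⟨i, hi⟩ := h1
  obtain ⟨j, hj⟩ := h2
  have hij : ∀ a b, X.color (v a) = m + 1 → X.color (v b) = m + 2 →
      X.label (v a) m = X.label (v b) m := by
    intro a b ha hb
    rcases hv a b with h | h
    · rw [ha, hb] at h
      exact absurd h a3
    · exact h m (by rwa [ha]) (by rwa [hb])
  refine ⟨(m, X.label (v i) m), fun a => ?_, ⟨i, hi, rfl⟩, ⟨j, hj, (hij i j hi hj).symm⟩⟩
  rcases hcol a with h | h
  · exact Or.inl ⟨h, (hij a j h hj).trans (hij i j hi hj).symm⟩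
  · exact Or.inr ⟨h, (hij i a hi h).symm⟩

lemma adj_of_ne_zero {c : (Fin q → V) → 𝕜} (hc : c ∈ orientedChains 𝕜 K q) {v : Fin q → V}
    (hv : c v ≠ 0) (i j) : X.color (v i) = X.color (v j) ∨
      ∀ m, m ≠ X.color (v i) → m ≠ X.color (v j) → X.label (v i) m = X.label (v j) m := by
  have : (Set.finite_range v).toFinset ∈ K := by
    by_contra h
    exact hv (hc.2.1 v ⟨_, i, rfl⟩ h)
  exact ((X.mem_iff _).1 this).2 _ (by simp) _ (by simp)

variable [Fintype V]

/-- A non-rainbow face that contains a tuple mixed in `s` is itself mixed in `s`, so the discarded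
simplices do not contribute to the boundary at such a tuple. -/
lemma boundaryMap_restrict_mixed {c : (Fin (q + 1) → V) → 𝕜}
    (hc : c ∈ orientedChains 𝕜 K (q + 1)) (hr : ∀ v, X.Rainbow v → c v = 0)
    {s : Fin 3 × Fin k} {v : Fin q → V} (hv : X.Mixed s v) :
    boundaryMap 𝕜 V q (restrictChain 𝕜 (X.Mixed s) c) v = boundaryMap 𝕜 V q c v := by
  rw [boundaryMap_apply, boundaryMap_apply]
  refine Finset.sum_congr rfl fun x _ => ?_
  by_cases h : X.Mixed s (Fin.cons x v : Fin (q + 1) → V)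
  · exact restrictChain_of_pos c h
  rw [restrictChain_of_neg c h]
  by_contra h0
  have h0 := Ne.symm h0
  obtain ⟨i, hi⟩ := hv.2.1
  obtain ⟨j, hj⟩ := hv.2.2
  have hnc : ¬ ∃ t, ∀ a, X.color ((Fin.cons x v : Fin (q + 1) → V) a) = t := by
    rintro ⟨t, ht⟩
    have h1 := ht i.succ
    have h2 := ht j.succ
    simp only [Fin.cons_succ] at h1 h2
    rw [hi.1] at h1
    rw [hj.1, ← h1] at h2
    revert h2
    generalize s.1 = m
    revert m
    decide
  obtain ⟨s', hs'⟩ := X.exists_mixed (X.adj_of_ne_zero hc h0) (fun h => h0 (hr _ h)) hnc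
  have hs'v : X.Mixed s' v := by
    have h1 : ∀ a, v a ∈ X.left s' ∪ X.right s' := fun a => by simpa using hs'.1 a.succ
    have h2 : ∀ m : Fin 3, m + 1 ≠ m + 2 := by decide
    have hcol : X.color (v i) ≠ X.color (v j) := by
      rw [hi.1, hj.1]
      exact h2 _
    refine ⟨h1, ?_, ?_⟩
    · by_contra! h
      have hi' := (h1 i).resolve_left (h i)
      have hj' := (h1 j).resolve_left (h j)
      exact hcol (hi'.1.trans hj'.1.symm)
    · by_contra! h
      have hi' := (h1 i).resolve_right (h i)
      have hj' := (h1 j).resolve_right (h j)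
      exact hcol (hi'.1.trans hj'.1.symm)
  rw [hv.unique hs'v] at h
  exact h hs'

/-- The part at the left end of the boundary of the part of `c` in the tube `s`, composed with
one more boundary operator. -/
noncomputable def tubeBoundary (𝕜 : Type*) [Field 𝕜] (X : TubeComplex K k) (q : ℕ)
    (s : Fin 3 × Fin k) : ((Fin (q + 2) → V) → 𝕜) →ₗ[𝕜] ((Fin q → V) → 𝕜) :=
  boundaryMap 𝕜 V q ∘ₗ restrictChain 𝕜 (fun v => ∀ i, v i ∈ X.left s) ∘ₗ
    boundaryMap 𝕜 V (q + 1) ∘ₗ restrictChain 𝕜 (X.Mixed s)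

/-- Inside a tube the boundary of the mixed part agrees with that of `c` at mixed tuples, hence
vanishes there; what survives lies in one end. This is the hypothesis on boundaries in
`exists_boundaryMap_eq_of_join`. -/
lemma boundary_pure {c : (Fin (q + 2) → V) → 𝕜} (hc : c ∈ orientedChains 𝕜 K (q + 2))
    (hr : ∀ v, X.Rainbow v → c v = 0) (hcyc : boundaryMap 𝕜 V (q + 1) c = 0)
    (s : Fin 3 × Fin k) (v : Fin (q + 1) → V)
    (hv : boundaryMap 𝕜 V (q + 1) (restrictChain 𝕜 (X.Mixed s) c) v ≠ 0) :
    (∀ i, v i ∈ X.left s) ∨ ∀ i, v i ∈ X.right s := by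
  have h1 := boundaryMap_support (T := X.left s ∪ X.right s)
    (fun v hv => (restrictChain_ne_zero hv).1.1) v hv
  by_contra! h
  obtain ⟨⟨i, hi⟩, ⟨j, hj⟩⟩ := h
  have hm : X.Mixed s v := ⟨h1, ⟨j, (h1 j).resolve_right hj⟩, ⟨i, (h1 i).resolve_left hi⟩⟩
  rw [X.boundaryMap_restrict_mixed hc hr hm, hcyc] at hv
  exact hv rfl

/-- A cycle without rainbow simplices, whose boundaries in all tubes are cycles at the ends, bounds
a chain without rainbow simplices. -/
theorem exists_boundaryMap_eq {c : (Fin (q + 2) → V) → 𝕜}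
    (hc : c ∈ orientedChains 𝕜 K (q + 2)) (hr : ∀ v, X.Rainbow v → c v = 0)
    (hcyc : boundaryMap 𝕜 V (q + 1) c = 0) (htube : ∀ s, tubeBoundary 𝕜 X q s c = 0) :
    ∃ d ∈ orientedChains 𝕜 K (q + 3), (∀ v, X.Rainbow v → d v = 0) ∧
      boundaryMap 𝕜 V (q + 2) d = c := by
  have h1 : ∀ s, ∃ d ∈ orientedChains 𝕜 K (q + 3),
      (∀ v, d v ≠ 0 → ∀ i, v i ∈ X.left s ∪ X.right s) ∧
      ∀ v, restrictChain 𝕜 (X.Mixed s) c v - boundaryMap 𝕜 V (q + 2) d v ≠ 0 →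
        (∀ i, v i ∈ X.left s) ∨ (∀ i, v i ∈ X.right s) := fun s =>
    exists_boundaryMap_eq_of_join (X.tube_mem s) (X.disjoint_left_right s)
      (restrictChain_mem (X.mixed_comp s) hc) (fun v hv => (restrictChain_ne_zero hv).1.1)
      (X.boundary_pure hc hr hcyc s) (htube s)
  choose d hdK hdT hd using h1
  -- After the tube fillings are subtracted, only simplices inside single clusters remain.
  set c' := c - boundaryMap 𝕜 V (q + 2) (∑ s, d s) with hc'
  have hDK : ∑ s, d s ∈ orientedChains 𝕜 K (q + 3) := sum_mem fun s _ => hdK s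
  have hc'K : c' ∈ orientedChains 𝕜 K (q + 2) := sub_mem hc (boundaryMap_mem_orientedChains hDK)
  have hc'cyc : boundaryMap 𝕜 V (q + 1) c' = 0 := by
    rw [hc', map_sub, hcyc, boundaryMap_boundaryMap hDK, sub_zero]
  have hd_rainbow : ∀ s v, X.Rainbow v → d s v = 0 := by
    intro s v hv
    by_contra h
    obtain ⟨i, hi⟩ := hv s.1
    have h2 : ∀ m : Fin 3, m ≠ m + 1 ∧ m ≠ m + 2 := by decide
    rcases hdT s v h i with h' | h'
    · exact (h2 s.1).1 (hi.symm.trans h'.1)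
    · exact (h2 s.1).2 (hi.symm.trans h'.1)
  have hc'r : ∀ v, X.Rainbow v → c' v = 0 := by
    intro v hv
    rw [hc', Pi.sub_apply, hr v hv, map_sum, Finset.sum_apply, zero_sub, neg_eq_zero]
    refine Finset.sum_eq_zero fun s _ => ?_
    by_contra h
    obtain ⟨i, hi⟩ := hv s.1
    have h2 : ∀ m : Fin 3, m ≠ m + 1 ∧ m ≠ m + 2 := by decide
    rcases boundaryMap_support (hdT s) v h i with h' | h'
    · exact (h2 s.1).1 (hi.symm.trans h'.1)
    · exact (h2 s.1).2 (hi.symm.trans h'.1)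
  have hmono : ∀ v, c' v ≠ 0 → ∃ t, ∀ i, X.color (v i) = t := by
    intro v hv
    by_contra hm
    obtain ⟨s, hs⟩ := X.exists_mixed (X.adj_of_ne_zero hc'K hv) (fun h => hv (hc'r v h)) hm
    refine hv ?_
    have h2 : c v = ∑ s, restrictChain 𝕜 (X.Mixed s) c v := by
      rw [Finset.sum_eq_single s, restrictChain_of_pos c hs]
      · exact fun s' _ hs' => restrictChain_of_neg c fun h => hs' (h.unique hs)
      · simp
    rw [hc', Pi.sub_apply, h2, map_sum, Finset.sum_apply, ← Finset.sum_sub_distrib]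
    refine Finset.sum_eq_zero fun s' _ => ?_
    by_contra h
    refine hm ?_
    rcases hd s' v h with h | h
    · exact ⟨_, fun i => (h i).1⟩
    · exact ⟨_, fun i => (h i).1⟩
  -- The part of `c'` in each cluster is a cycle by itself: a nonempty face of a monochromatic
  -- simplex has its color, so different clusters cannot cancel. It is filled within the cluster.
  have h2 : ∀ t : Fin 3, ∃ d ∈ orientedChains 𝕜 K (q + 3),
      (∀ v, d v ≠ 0 → ∀ i, v i ∈ {x | X.color x = t}) ∧
      boundaryMap 𝕜 V (q + 2) d = restrictChain 𝕜 (fun v => ∀ i, v i ∈ {x | X.color x = t}) c' := by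
    intro t
    refine exists_boundaryMap_eq_of_simplex (X.cluster_mem t)
      (restrictChain_mem (forall_comp_perm (· ∈ {x | X.color x = t})) hc'K)
      (fun v hv => (restrictChain_ne_zero hv).1) ?_
    funext v
    by_contra h
    have hvt := boundaryMap_support (T := {x | X.color x = t})
      (fun v hv => (restrictChain_ne_zero hv).1) v h
    refine h (Eq.trans ?_ (congrFun hc'cyc v))
    rw [boundaryMap_apply, boundaryMap_apply]
    refine Finset.sum_congr rfl fun x _ => ?_
    by_cases hx : c' (Fin.cons x v) = 0
    · by_contra h
      rw [hx] at h
      exact (restrictChain_ne_zero h).2 hx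
    · obtain ⟨t', ht'⟩ := hmono _ hx
      refine restrictChain_of_pos c' fun i => ?_
      have h0 : t' = t := by
        rw [← ht' (Fin.succ 0), Fin.cons_succ]
        exact hvt 0
      exact (ht' i).trans h0
  choose e heK heT he using h2
  refine ⟨∑ s, d s + ∑ t, e t, add_mem hDK (sum_mem fun t _ => heK t), fun v hv => ?_, ?_⟩
  · rw [Pi.add_apply, Finset.sum_apply, Finset.sum_apply,
      Finset.sum_eq_zero fun s _ => hd_rainbow s v hv, Finset.sum_eq_zero, add_zero]
    intro t _
    by_contra h
    obtain ⟨i, hi⟩ := hv (t + 1)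
    have h3 : ∀ t : Fin 3, t + 1 ≠ t := by decide
    exact h3 t (hi.symm.trans (heT t v h i))
  · rw [map_add, map_sum (boundaryMap 𝕜 V (q + 2)) e]
    simp only [he]
    have : c' = ∑ t, restrictChain 𝕜 (fun v => ∀ i, v i ∈ {x | X.color x = t}) c' := by
      funext v
      rw [Finset.sum_apply]
      by_cases hv : c' v = 0
      · rw [hv, Finset.sum_eq_zero]
        intro t _
        by_contra h
        exact (restrictChain_ne_zero h).2 hv
      · obtain ⟨t, ht⟩ := hmono v hv
        rw [Finset.sum_eq_single t]
        · exact (restrictChain_of_pos c' ht).symm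
        · intro t' _ htt'
          exact restrictChain_of_neg c' fun h => htt' ((h 0).symm.trans (ht 0))
        · simp
    rw [← this, hc', add_sub_cancel]

/-- The condition on the tubes holds automatically for `2`-cycles. -/
lemma tubeBoundary_eq_zero {c : (Fin 3 → V) → 𝕜} (hc : c ∈ orientedChains 𝕜 K 3)
    (hr : ∀ v, X.Rainbow v → c v = 0) (hcyc : boundaryMap 𝕜 V 2 c = 0) (s : Fin 3 × Fin k) :
    tubeBoundary 𝕜 X 1 s c = 0 := by
  change boundaryMap 𝕜 V 1 (restrictChain 𝕜 (fun v => ∀ i, v i ∈ X.left s)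
    (boundaryMap 𝕜 V 2 (restrictChain 𝕜 (X.Mixed s) c))) = 0
  set b := boundaryMap 𝕜 V 2 (restrictChain 𝕜 (X.Mixed s) c) with hb
  have hpure : ∀ v, b v ≠ 0 → (∀ i, v i ∈ X.left s) ∨ ∀ i, v i ∈ X.right s :=
    X.boundary_pure hc hr hcyc s
  have hbb : boundaryMap 𝕜 V 1 b = 0 :=
    boundaryMap_boundaryMap (restrictChain_mem (X.mixed_comp s) hc)
  funext v
  by_contra h
  have hv := boundaryMap_support (T := X.left s) (fun v hv => (restrictChain_ne_zero hv).1) v h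
  refine h (Eq.trans ?_ (congrFun hbb v))
  rw [boundaryMap_apply, boundaryMap_apply]
  refine Finset.sum_congr rfl fun x _ => ?_
  by_cases hx : b (Fin.cons x v) = 0
  · by_contra h
    rw [hx] at h
    exact (restrictChain_ne_zero h).2 hx
  -- Here `v` has one entry, and it lies at the left end, which excludes simplices at the right end.
  -- For `q = 0` the tuple is empty and this argument fails, so the tubes do obstruct 1-cycles.
  · rcases hpure _ hx with h' | h'
    · exact restrictChain_of_pos b h'
    · have := h' (Fin.succ 0)
      rw [Fin.cons_succ] at this
      exact absurd this (Set.disjoint_left.1 (X.disjoint_left_right s) (hv 0))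

end TubeComplex

end Tubes

/-! ### Rainbow triangles and the second Betti number -/

section RainbowTriangles

variable {V 𝕜 : Type*} [Field 𝕜] {k : ℕ} {K : AbstractSimplicialComplex V}

namespace TubeComplex

variable (X : TubeComplex K k)

/-- The rainbow triangle with labels `L`. -/
def triangle (L : Fin 3 → Fin k) : Fin 3 → V := fun t => X.pt t L

lemma triangle_mem (L : Fin 3 → Fin k) :
    (Set.finite_range (X.triangle L)).toFinset ∈ K := by
  refine (X.mem_iff _).2 ⟨⟨X.triangle L 0, by simp⟩, fun x hx y hy => Or.inr fun m h1 h2 => ?_⟩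
  simp only [Set.Finite.mem_toFinset, Set.mem_range] at hx hy
  obtain ⟨i, rfl⟩ := hx
  obtain ⟨j, rfl⟩ := hy
  simp only [triangle, X.color_pt] at h1 h2 ⊢
  rw [X.label_pt _ _ _ h1, X.label_pt _ _ _ h2]

lemma triangle_rainbow (L : Fin 3 → Fin k) : X.Rainbow (X.triangle L) :=
  fun t => ⟨t, X.color_pt t L⟩

/-- The labels of a rainbow triangle. -/
def triangleLabel (v : Fin 3 → V) : Fin 3 → Fin k := fun m => X.label (v (m + 1)) m

lemma triangleLabel_triangle (L : Fin 3 → Fin k) : X.triangleLabel (X.triangle L) = L := by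
  have h : ∀ m : Fin 3, m ≠ m + 1 := by decide
  exact funext fun m => X.label_pt _ _ _ (h m)

/-- `triangleLabel` reads the label for `m` at the vertex of color `m + 1`; adjacency carries it to
the other vertex whose color is not `m`. -/
lemma eq_triangle {v : Fin 3 → V} (hcol : ∀ t, X.color (v t) = t)
    (hv : ∀ i j, X.color (v i) = X.color (v j) ∨
      ∀ m, m ≠ X.color (v i) → m ≠ X.color (v j) → X.label (v i) m = X.label (v j) m) :
    v = X.triangle (X.triangleLabel v) := by
  have h : ∀ m : Fin 3, m ≠ m + 1 := by decide
  funext t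
  refine X.eq_of_label _ _ ((hcol t).trans (X.color_pt t _).symm) fun m hm => ?_
  rw [hcol] at hm
  rw [triangle, X.label_pt _ _ _ hm, triangleLabel]
  rcases hv t (m + 1) with h' | h'
  · rw [hcol, hcol] at h'
    rw [h']
  · simp only [hcol] at h'
    exact h' m hm (h m)

/-- A chain is determined to vanish on all rainbow tuples by its values at the rainbow
triangles. -/
lemma eq_zero_of_rainbow {c : (Fin 3 → V) → 𝕜} (hc : c ∈ orientedChains 𝕜 K 3)
    (h : ∀ L, c (X.triangle L) = 0) {v : Fin 3 → V} (hv : X.Rainbow v) : c v = 0 := by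
  by_contra h0
  let σ : Equiv.Perm (Fin 3) := Equiv.ofBijective (fun i => X.color (v i))
    (Finite.injective_iff_bijective.1 (Finite.injective_iff_surjective.2 hv))
  have h1 : c (v ∘ (σ⁻¹ : Equiv.Perm (Fin 3))) ≠ 0 := by
    rw [hc.2.2]
    rcases Int.units_eq_one_or (Equiv.Perm.sign σ⁻¹) with h | h <;> simp [h, h0]
  have hcol : ∀ t, X.color ((v ∘ (σ⁻¹ : Equiv.Perm (Fin 3))) t) = t :=
    fun t => σ.apply_symm_apply t
  rw [X.eq_triangle hcol (X.adj_of_ne_zero hc h1)] at h1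
  exact h1 (h _)

open Classical in
/-- The chain of rainbow triangles with coefficients `f`. -/
noncomputable def rainbowChain (𝕜 : Type*) [Field 𝕜] :
    ((Fin 3 → Fin k) → 𝕜) →ₗ[𝕜] ((Fin 3 → V) → 𝕜) where
  toFun f := fun v => ∑ σ : Equiv.Perm (Fin 3), ((Equiv.Perm.sign σ : ℤ) : 𝕜) *
    if (∀ t, X.color (v (σ t)) = t) ∧ (Set.finite_range v).toFinset ∈ K then
      f (X.triangleLabel (v ∘ σ)) else 0
  map_add' f g := by
    funext v
    rw [Pi.add_apply, ← Finset.sum_add_distrib]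
    refine Finset.sum_congr rfl fun σ _ => ?_
    split_ifs <;> simp [mul_add]
  map_smul' r f := by
    funext v
    rw [RingHom.id_apply, Pi.smul_apply, Finset.smul_sum]
    refine Finset.sum_congr rfl fun σ _ => ?_
    split_ifs <;> simp [mul_left_comm]

lemma rainbowChain_apply (f : (Fin 3 → Fin k) → 𝕜) (v : Fin 3 → V) :
    X.rainbowChain 𝕜 f v = ∑ σ : Equiv.Perm (Fin 3), ((Equiv.Perm.sign σ : ℤ) : 𝕜) *
      open Classical in
      if (∀ t, X.color (v (σ t)) = t) ∧ (Set.finite_range v).toFinset ∈ K then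
        f (X.triangleLabel (v ∘ σ)) else 0 := rfl

/-- At most one permutation contributes at a given tuple, the one that sorts the entries by color.
Left translation in the sum over permutations gives the alternation. -/
lemma rainbowChain_mem (f : (Fin 3 → Fin k) → 𝕜) :
    X.rainbowChain 𝕜 f ∈ orientedChains 𝕜 K 3 := by
  refine ⟨fun v hv => ?_, fun v _ hv' => ?_, fun v τ => ?_⟩
  · rw [rainbowChain_apply]
    refine Finset.sum_eq_zero fun σ _ => ?_
    rw [if_neg, mul_zero]
    rintro ⟨h, -⟩
    refine hv fun i j hij => ?_
    obtain ⟨i, rfl⟩ := σ.surjective i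
    obtain ⟨j, rfl⟩ := σ.surjective j
    rw [← h i, ← h j, hij]
  · rw [rainbowChain_apply]
    refine Finset.sum_eq_zero fun σ _ => ?_
    rw [if_neg fun h => hv' h.2, mul_zero]
  · rw [rainbowChain_apply, rainbowChain_apply, Finset.mul_sum]
    refine Fintype.sum_equiv (Equiv.mulLeft τ) _ _ fun σ => ?_
    have hr : (Set.finite_range (v ∘ τ)).toFinset = (Set.finite_range v).toFinset := by
      ext x
      simp only [Set.Finite.mem_toFinset, EquivLike.range_comp]
    rw [hr, Equiv.coe_mulLeft, Equiv.Perm.sign_mul, ← mul_assoc]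
    congr 1
    rcases Int.units_eq_one_or (Equiv.Perm.sign τ) with h | h <;> simp [h]

lemma rainbowChain_triangle (f : (Fin 3 → Fin k) → 𝕜) (L : Fin 3 → Fin k) :
    X.rainbowChain 𝕜 f (X.triangle L) = f L := by
  rw [rainbowChain_apply, Finset.sum_eq_single 1]
  · rw [if_pos ⟨fun t => X.color_pt t L, X.triangle_mem L⟩]
    simp [triangleLabel_triangle]
  · intro σ _ hσ
    rw [if_neg, mul_zero]
    rintro ⟨h, -⟩
    refine hσ (Equiv.ext fun t => ?_)
    exact (X.color_pt (σ t) L).symm.trans (h t)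
  · simp

variable [Fintype V]

/-- No tetrahedron has a rainbow triangle as a face. -/
lemma boundaryMap_triangle {d : (Fin 4 → V) → 𝕜} (hd : d ∈ orientedChains 𝕜 K 4)
    (L : Fin 3 → Fin k) : boundaryMap 𝕜 V 3 d (X.triangle L) = 0 := by
  rw [boundaryMap_apply]
  refine Finset.sum_eq_zero fun x _ => ?_
  by_contra h
  have hadj := X.adj_of_ne_zero hd h
  -- The fourth vertex repeats a color. For each label `m` it carries, it is adjacent to the
  -- triangle vertex of the third color `t`, which forces that label to be `L m`; hence it coincides
  -- with a vertex of the triangle.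
  have hx : x = X.pt (X.color x) L := by
    refine X.eq_of_label _ _ (X.color_pt _ _).symm fun m hm => ?_
    have aux : ∀ c m : Fin 3, m ≠ c → ∃ t, t ≠ c ∧ t ≠ m := by decide
    obtain ⟨t, htc, htm⟩ := aux _ _ hm
    rw [X.label_pt _ _ _ hm]
    have := hadj 0 (Fin.succ t)
    simp only [Fin.cons_zero, Fin.cons_succ, triangle, X.color_pt] at this
    rw [this.resolve_left htc.symm m hm htm.symm, X.label_pt _ _ _ htm.symm]
  have hinj : Function.Injective (Fin.cons x (X.triangle L) : Fin 4 → V) := by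
    by_contra h'
    exact h (hd.1 _ h')
  exact (Fin.cons_injective_iff.1 hinj).1 ⟨X.color x, hx.symm⟩

/-- The values of a `2`-cycle at the rainbow triangles. -/
def evalTriangles (𝕜 : Type*) [Field 𝕜] :
    simplicialCycles 𝕜 K 2 →ₗ[𝕜] ((Fin 3 → Fin k) → 𝕜) where
  toFun c := fun L => c.1 (X.triangle L)
  map_add' _ _ := rfl
  map_smul' _ _ := rfl

/-- A cycle that vanishes at the rainbow triangles has no rainbow simplices at all and is filled by
`exists_boundaryMap_eq`; conversely, no boundary involves a rainbow triangle. -/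
lemma ker_evalTriangles : LinearMap.ker (X.evalTriangles 𝕜) =
    (simplicialBoundaries 𝕜 K 2).submoduleOf (simplicialCycles 𝕜 K 2) := by
  ext ⟨c, hc⟩
  rw [LinearMap.mem_ker, Submodule.submoduleOf, Submodule.mem_comap]
  constructor
  · intro h
    have hr : ∀ v, X.Rainbow v → c v = 0 := fun v hv =>
      X.eq_zero_of_rainbow hc.1 (fun L => congrFun h L) hv
    obtain ⟨d, hd, -, hdc⟩ := X.exists_boundaryMap_eq hc.1 hr hc.2
      (X.tubeBoundary_eq_zero hc.1 hr hc.2)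
    exact ⟨d, hd, hdc⟩
  · rintro ⟨d, hd, hdc⟩
    funext L
    change c (X.triangle L) = 0
    rw [← show boundaryMap 𝕜 V 3 d = c from hdc]
    exact X.boundaryMap_triangle hd L

lemma reducedBetti_eq : reducedBetti 𝕜 K 2 =
    Module.finrank 𝕜 (LinearMap.range (X.evalTriangles 𝕜)) := by
  rw [reducedBetti, ← ker_evalTriangles]
  exact (X.evalTriangles 𝕜).quotKerEquivRange.finrank_eq

theorem reducedBetti_le (X : TubeComplex K k) : reducedBetti 𝕜 K 2 ≤ k ^ 3 := by
  rw [X.reducedBetti_eq]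
  refine (Submodule.finrank_le _).trans ?_
  rw [Module.finrank_fintype_fun_eq_card]
  simp

/-- The obstructions, one for each tube, to extending a chain of rainbow triangles to a cycle. -/
noncomputable def obstruction (𝕜 : Type*) [Field 𝕜] :
    ((Fin 3 → Fin k) → 𝕜) →ₗ[𝕜] (Fin 3 × Fin k → 𝕜) :=
  LinearMap.pi fun s => LinearMap.proj default ∘ₗ tubeBoundary 𝕜 X 0 s ∘ₗ
    boundaryMap 𝕜 V 2 ∘ₗ X.rainbowChain 𝕜

/-- The boundary of a rainbow chain is a 1-cycle. When the obstructions vanish it also bounds a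
chain without rainbow simplices; subtracting that chain gives a cycle with the same rainbow
coefficients. -/
lemma ker_obstruction_le :
    LinearMap.ker (X.obstruction 𝕜) ≤ LinearMap.range (X.evalTriangles 𝕜) := by
  intro f hf
  have hF := X.rainbowChain_mem (𝕜 := 𝕜) f
  have hr : ∀ v : Fin 2 → V, X.Rainbow v → boundaryMap 𝕜 V 2 (X.rainbowChain 𝕜 f) v = 0 := by
    intro v hv
    have := Fintype.card_le_of_surjective (fun i => X.color (v i)) hv
    simp at this
  obtain ⟨d, hdK, hdr, hd⟩ := X.exists_boundaryMap_eq (q := 0) (boundaryMap_mem_orientedChains hF)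
    hr (boundaryMap_boundaryMap hF) (fun s => by
      funext v
      -- For `q = 0` the tube condition is one scalar, the value at the empty tuple.
      rw [Subsingleton.elim v default]
      exact congrFun hf s)
  refine ⟨⟨X.rainbowChain 𝕜 f - d, sub_mem hF hdK, ?_⟩, ?_⟩
  · change boundaryMap 𝕜 V 2 (_ - d) = 0
    rw [map_sub, sub_eq_zero]
    exact hd.symm
  · funext L
    change X.rainbowChain 𝕜 f (X.triangle L) - d (X.triangle L) = f L
    rw [hdr _ (X.triangle_rainbow L), X.rainbowChain_triangle, sub_zero]

/-- Rank-nullity for the obstruction map from a space of dimension `k ^ 3` to one of dimension `3 *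
k`. -/
theorem le_reducedBetti (X : TubeComplex K k) : k ^ 3 ≤ reducedBetti 𝕜 K 2 + 3 * k := by
  have h1 := (X.obstruction 𝕜).finrank_range_add_finrank_ker
  have h2 := Submodule.finrank_mono X.ker_obstruction_le (R := 𝕜)
  have h3 := Submodule.finrank_le (LinearMap.range (X.obstruction 𝕜))
  rw [← X.reducedBetti_eq] at h2
  simp only [Module.finrank_fintype_fun_eq_card, Fintype.card_prod, Fintype.card_fun,
    Fintype.card_fin] at h1 h3
  omega

end TubeComplex

end RainbowTriangles

/-! ### Distances in the configuration -/

section Distances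

lemma dist_le_one_iff {d : ℕ} (x y : EuclideanSpace ℝ (Fin d)) :
    dist x y ≤ 1 ↔ ∑ i, (x i - y i) ^ 2 ≤ 1 := by
  have h := EuclideanSpace.dist_sq_eq x y
  simp only [Real.dist_eq, sq_abs] at h
  rw [← h, sq_le_one_iff₀ dist_nonneg]

variable {n k : ℕ}

lemma abs_angle_sub_le (hn : 3 * k ^ 2 ≤ n) (hk : 7 ≤ k) {i a : ℕ} (hi : i ∈ Finset.Icc 1 k)
    (ha : a ∈ Finset.Icc 1 k) : |(i : ℝ) * (1 / (n : ℝ)) - a * (1 / (n : ℝ))| ≤ 1 / 21 := by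
  rw [Finset.mem_Icc] at hi ha
  have hi1 : (1 : ℝ) ≤ i := by exact_mod_cast hi.1
  have hi2 : (i : ℝ) ≤ k := by exact_mod_cast hi.2
  have ha1 : (1 : ℝ) ≤ a := by exact_mod_cast ha.1
  have ha2 : (a : ℝ) ≤ k := by exact_mod_cast ha.2
  have hk' : (7 : ℝ) ≤ k := by exact_mod_cast hk
  have hn' : 3 * (k : ℝ) ^ 2 ≤ n := by exact_mod_cast hn
  have hkn : 21 * (k : ℝ) ≤ n := by nlinarith
  have hn0 : (0 : ℝ) < n := by linarith
  rw [← sub_mul, abs_mul, abs_of_pos (by positivity : (0 : ℝ) < 1 / n), mul_one_div,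
    div_le_div_iff₀ hn0 (by norm_num)]
  have : |(i : ℝ) - a| ≤ k := abs_le.2 ⟨by linarith, by linarith⟩
  linarith

/-- The comparison of the two scales of the configuration. -/
lemma height_lt (hn : 3 * k ^ 2 ≤ n) (hk : 7 ≤ k) {j : ℕ} (hj : j ∈ Finset.Icc 1 k) :
    0 < (j : ℝ) * (1 / (n : ℝ) ^ 3) ∧ √3 * ((j : ℝ) * (1 / (n : ℝ) ^ 3)) < 1 / (10 * n ^ 2) := by
  rw [Finset.mem_Icc] at hj
  have hj1 : (1 : ℝ) ≤ j := by exact_mod_cast hj.1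
  have hj2 : (j : ℝ) ≤ k := by exact_mod_cast hj.2
  have hk' : (7 : ℝ) ≤ k := by exact_mod_cast hk
  have hn' : 3 * (k : ℝ) ^ 2 ≤ n := by exact_mod_cast hn
  have hn0 : (0 : ℝ) < n := by nlinarith
  have h3 : √3 < 9 / 5 := by
    rw [Real.sqrt_lt' (by norm_num)]
    norm_num
  refine ⟨by positivity, ?_⟩
  rw [← mul_assoc, mul_one_div, div_lt_div_iff₀ (by positivity) (by positivity)]
  -- The bound `7 ≤ k` enters here: `10 * √3 < 18`, while `n ≥ 3 * k ^ 2 ≥ 21 * k`.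
  have h1 : √3 * j * 10 < n := by
    have : √3 * j ≤ 9 / 5 * j := by gcongr
    nlinarith
  calc √3 * j * (10 * (n : ℝ) ^ 2) = √3 * j * 10 * (n : ℝ) ^ 2 := by ring
    _ < n * (n : ℝ) ^ 2 := by gcongr
    _ = 1 * (n : ℝ) ^ 3 := by ring

lemma height_le (hn : 3 * k ^ 2 ≤ n) (hk : 7 ≤ k) {j : ℕ} (hj : j ∈ Finset.Icc 1 k) :
    (j : ℝ) * (1 / (n : ℝ) ^ 3) < 1 / 10 := by
  have h := height_lt hn hk hj
  have h3 : (1 : ℝ) ≤ √3 := Real.one_le_sqrt.2 (by norm_num)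
  have hn0 : (1 : ℝ) ≤ n := by
    have : 1 ≤ n := by nlinarith
    exact_mod_cast this
  calc (j : ℝ) * (1 / (n : ℝ) ^ 3) ≤ √3 * ((j : ℝ) * (1 / (n : ℝ) ^ 3)) :=
        le_mul_of_one_le_left h.1.le h3
    _ < 1 / (10 * n ^ 2) := h.2
    _ ≤ 1 / 10 := by
        apply one_div_le_one_div_of_le (by norm_num)
        nlinarith

lemma one_sub_cos_le (x : ℝ) (hx : |x| ≤ 1 / 21) : 1 - Real.cos x ≤ 1 / 10 := by
  have h := Real.one_sub_sq_div_two_le_cos (x := x)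
  have h2 := abs_le.1 hx
  nlinarith

/-- The left side is the squared distance from `u_{i,j}` to `w_{a,b}`. With equal angles the height
`j * ε` brings it slightly below 1. Distinct angles add at least `1 / (10 * n ^ 2)`, which exceeds
the gain `√3 * j * ε`. -/
lemma uw_criterion (hn : 3 * k ^ 2 ≤ n) (hk : 7 ≤ k) {i a j : ℕ} (hi : i ∈ Finset.Icc 1 k)
    (ha : a ∈ Finset.Icc 1 k) (hj : j ∈ Finset.Icc 1 k) :
    3 / 2 - 1 / 2 * Real.cos (i * (1 / (n : ℝ)) - a * (1 / (n : ℝ))) -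
      √3 * ((j : ℝ) * (1 / (n : ℝ) ^ 3)) + ((j : ℝ) * (1 / (n : ℝ) ^ 3)) ^ 2 ≤ 1 ↔ i = a := by
  obtain ⟨h1, h2⟩ := height_lt hn hk hj
  have h3 := height_le hn hk hj
  have hn0 : (0 : ℝ) < n := by
    have : 0 < n := by nlinarith
    exact_mod_cast this
  constructor
  · intro h
    by_contra hne
    have hx := abs_angle_sub_le hn hk hi ha
    have hc := Real.cos_le_one_sub_mul_cos_sq (hx.trans (by linarith [Real.pi_gt_three]))
    have hsq : 1 / (n : ℝ) ^ 2 ≤ ((i : ℝ) * (1 / (n : ℝ)) - a * (1 / (n : ℝ))) ^ 2 := by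
      rw [← sub_mul, mul_pow, div_pow, one_pow]
      refine le_mul_of_one_le_left (by positivity) ?_
      have : (1 : ℤ) ≤ ((i : ℤ) - a) ^ 2 := by
        have : (i : ℤ) - a ≠ 0 := by omega
        exact Int.add_one_le_iff.2 (sq_pos_iff.2 this)
      exact_mod_cast this
    -- From `π ^ 2 ≤ 10`; this is the origin of the 10 in `height_lt`.
    have hpi : (1 : ℝ) / 5 ≤ 2 / Real.pi ^ 2 := by
      rw [div_le_div_iff₀ (by norm_num) (by positivity)]
      nlinarith [Real.pi_lt_d2, Real.pi_gt_three]
    have h5 : 1 / 5 * (1 / (n : ℝ) ^ 2) ≤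
        2 / Real.pi ^ 2 * ((i : ℝ) * (1 / (n : ℝ)) - a * (1 / (n : ℝ))) ^ 2 := by gcongr
    have h6 : 1 / (10 * (n : ℝ) ^ 2) = 1 / 2 * (1 / 5 * (1 / (n : ℝ) ^ 2)) := by
      field_simp
      norm_num
    nlinarith
  · rintro rfl
    have h3' : (1 : ℝ) ≤ √3 := Real.one_le_sqrt.2 (by norm_num)
    rw [sub_self, Real.cos_zero]
    nlinarith

lemma uPoint_dist_uPoint (hn : 3 * k ^ 2 ≤ n) (hk : 7 ≤ k) {i j i' j' : ℕ}
    (hi : i ∈ Finset.Icc 1 k) (hi' : i' ∈ Finset.Icc 1 k) (hj : j ∈ Finset.Icc 1 k)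
    (hj' : j' ∈ Finset.Icc 1 k) : dist (uPoint n i j) (uPoint n i' j') ≤ 1 := by
  have h1 := one_sub_cos_le _ (abs_angle_sub_le hn hk hi hi')
  have h2 := height_lt hn hk hj
  have h3 := height_lt hn hk hj'
  have h4 := height_le hn hk hj
  have h5 := height_le hn hk hj'
  rw [Real.cos_sub] at h1
  rw [dist_le_one_iff, Fin.sum_univ_five]
  simp only [uPoint, PiLp.toLp_apply, Matrix.cons_val]
  have hs : √2 ^ 2 = (2 : ℝ) := Real.sq_sqrt (by norm_num)
  have e1 := Real.sin_sq_add_cos_sq ((i : ℝ) * (1 / (n : ℝ)))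
  have e2 := Real.sin_sq_add_cos_sq ((i' : ℝ) * (1 / (n : ℝ)))
  set x := (i : ℝ) * (1 / (n : ℝ))
  set y := (i' : ℝ) * (1 / (n : ℝ))
  set a := (j : ℝ) * (1 / (n : ℝ) ^ 3)
  set b := (j' : ℝ) * (1 / (n : ℝ) ^ 3)
  have e : (√2 / 2 * Real.cos x - √2 / 2 * Real.cos y) ^ 2 +
      (√2 / 2 * Real.sin x - √2 / 2 * Real.sin y) ^ 2 =
      1 - (Real.cos x * Real.cos y + Real.sin x * Real.sin y) := by
    linear_combination (1 / 4 * ((Real.cos x - Real.cos y) ^ 2 + (Real.sin x - Real.sin y) ^ 2)) *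
      hs + 1 / 2 * e1 + 1 / 2 * e2
  rw [e]
  nlinarith

lemma vPoint_dist_vPoint (hn : 3 * k ^ 2 ≤ n) (hk : 7 ≤ k) {i j i' j' : ℕ}
    (hi : i ∈ Finset.Icc 1 k) (hi' : i' ∈ Finset.Icc 1 k) (hj : j ∈ Finset.Icc 1 k)
    (hj' : j' ∈ Finset.Icc 1 k) : dist (vPoint n i j) (vPoint n i' j') ≤ 1 := by
  have h := uPoint_dist_uPoint hn hk hi hi' hj hj'
  rw [dist_le_one_iff, Fin.sum_univ_five] at h ⊢
  simp only [uPoint, vPoint, PiLp.toLp_apply, Matrix.cons_val] at h ⊢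
  linarith

lemma wPoint_dist_wPoint (hn : 3 * k ^ 2 ≤ n) (hk : 7 ≤ k) {i j i' j' : ℕ}
    (hi : i ∈ Finset.Icc 1 k) (hi' : i' ∈ Finset.Icc 1 k) (hj : j ∈ Finset.Icc 1 k)
    (hj' : j' ∈ Finset.Icc 1 k) : dist (wPoint n i j) (wPoint n i' j') ≤ 1 := by
  have h1 := one_sub_cos_le _ (abs_angle_sub_le hn hk hi hi')
  have h2 := one_sub_cos_le _ (abs_angle_sub_le hn hk hj hj')
  rw [Real.cos_sub] at h1 h2
  rw [dist_le_one_iff, Fin.sum_univ_five]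
  simp only [wPoint, PiLp.toLp_apply, Matrix.cons_val]
  have hs : √2 ^ 2 = (2 : ℝ) := Real.sq_sqrt (by norm_num)
  have key : ∀ x y : ℝ, (√2 / 4 * Real.cos x - √2 / 4 * Real.cos y) ^ 2 +
      (√2 / 4 * Real.sin x - √2 / 4 * Real.sin y) ^ 2 =
      1 / 4 * (1 - (Real.cos x * Real.cos y + Real.sin x * Real.sin y)) := by
    intro x y
    linear_combination (1 / 16 * ((Real.cos x - Real.cos y) ^ 2 + (Real.sin x - Real.sin y) ^ 2)) *
      hs + 1 / 8 * Real.sin_sq_add_cos_sq x + 1 / 8 * Real.sin_sq_add_cos_sq y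
  have e1 := key (i * (1 / (n : ℝ))) (i' * (1 / (n : ℝ)))
  have e2 := key (j * (1 / (n : ℝ))) (j' * (1 / (n : ℝ)))
  linarith

/-- The two circles lie in orthogonal planes and have squared radius 1/2, so the squared distance is
1 plus the squared difference of the heights. -/
lemma uPoint_dist_vPoint (hn : n ≠ 0) (i j i' j' : ℕ) :
    dist (uPoint n i j) (vPoint n i' j') ≤ 1 ↔ j = j' := by
  rw [dist_le_one_iff, Fin.sum_univ_five]
  simp only [uPoint, vPoint, PiLp.toLp_apply, Matrix.cons_val]
  have hs : √2 ^ 2 = (2 : ℝ) := Real.sq_sqrt (by norm_num)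
  have e1 := Real.sin_sq_add_cos_sq ((i : ℝ) * (1 / (n : ℝ)))
  have e2 := Real.sin_sq_add_cos_sq ((i' : ℝ) * (1 / (n : ℝ)))
  set x := (i : ℝ) * (1 / (n : ℝ))
  set y := (i' : ℝ) * (1 / (n : ℝ))
  have e : (√2 / 2 * Real.cos x - 0) ^ 2 + (√2 / 2 * Real.sin x - 0) ^ 2 +
      (0 - √2 / 2 * Real.cos y) ^ 2 + (0 - √2 / 2 * Real.sin y) ^ 2 = 1 := by
    linear_combination (1 / 4 * (Real.cos x ^ 2 + Real.sin x ^ 2 + Real.cos y ^ 2 +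
      Real.sin y ^ 2)) * hs + 1 / 2 * e1 + 1 / 2 * e2
  rw [e, add_le_iff_nonpos_right]
  have hn' : (n : ℝ) ≠ 0 := by exact_mod_cast hn
  rw [← sub_mul, sq_nonpos_iff, mul_eq_zero, or_iff_left (by positivity), sub_eq_zero,
    Nat.cast_inj]

lemma uPoint_dist_wPoint (hn : 3 * k ^ 2 ≤ n) (hk : 7 ≤ k) {i a j : ℕ} (b : ℕ)
    (hi : i ∈ Finset.Icc 1 k) (ha : a ∈ Finset.Icc 1 k) (hj : j ∈ Finset.Icc 1 k) :
    dist (uPoint n i j) (wPoint n a b) ≤ 1 ↔ i = a := by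
  rw [← uw_criterion hn hk hi ha hj, dist_le_one_iff, Fin.sum_univ_five, Real.cos_sub]
  simp only [uPoint, wPoint, PiLp.toLp_apply, Matrix.cons_val]
  have hs : √2 ^ 2 = (2 : ℝ) := Real.sq_sqrt (by norm_num)
  have hs3 : √3 ^ 2 = (3 : ℝ) := Real.sq_sqrt (by norm_num)
  have e1 := Real.sin_sq_add_cos_sq ((i : ℝ) * (1 / (n : ℝ)))
  have e2 := Real.sin_sq_add_cos_sq ((a : ℝ) * (1 / (n : ℝ)))
  have e3 := Real.sin_sq_add_cos_sq ((b : ℝ) * (1 / (n : ℝ)))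
  set x := (i : ℝ) * (1 / (n : ℝ))
  set y := (a : ℝ) * (1 / (n : ℝ))
  set z := (b : ℝ) * (1 / (n : ℝ))
  set t := (j : ℝ) * (1 / (n : ℝ) ^ 3)
  refine Iff.of_eq (congrArg (· ≤ 1) ?_)
  linear_combination (1 / 16 * ((2 * Real.cos x - Real.cos y) ^ 2 +
    (2 * Real.sin x - Real.sin y) ^ 2 + Real.cos z ^ 2 + Real.sin z ^ 2)) * hs + 1 / 4 * hs3 +
    1 / 2 * e1 + 1 / 8 * e2 + 1 / 8 * e3

lemma vPoint_dist_wPoint (hn : 3 * k ^ 2 ≤ n) (hk : 7 ≤ k) {i b j : ℕ} (a : ℕ)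
    (hi : i ∈ Finset.Icc 1 k) (hb : b ∈ Finset.Icc 1 k) (hj : j ∈ Finset.Icc 1 k) :
    dist (vPoint n i j) (wPoint n a b) ≤ 1 ↔ i = b := by
  rw [← uPoint_dist_wPoint hn hk a hi hb hj, dist_le_one_iff, dist_le_one_iff, Fin.sum_univ_five,
    Fin.sum_univ_five]
  simp only [uPoint, vPoint, wPoint, PiLp.toLp_apply, Matrix.cons_val]
  refine Iff.of_eq (congrArg (· ≤ 1) ?_)
  ring

/-- The points of the three clusters; the label of a point for the color `m` decides about its
adjacency to the points of the third cluster. -/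
noncomputable def clusterPoint (n : ℕ) (t : Fin 3) (L : Fin 3 → ℕ) : EuclideanSpace ℝ (Fin 5) :=
  ![uPoint n (L 1) (L 2), vPoint n (L 0) (L 2), wPoint n (L 1) (L 0)] t

lemma clusterPoint_dist_le_one_iff (hn : 3 * k ^ 2 ≤ n) (hk : 7 ≤ k) {L L' : Fin 3 → ℕ}
    (hL : ∀ m, L m ∈ Finset.Icc 1 k) (hL' : ∀ m, L' m ∈ Finset.Icc 1 k) (t t' : Fin 3) :
    dist (clusterPoint n t L) (clusterPoint n t' L') ≤ 1 ↔
      t = t' ∨ ∀ m, m ≠ t → m ≠ t' → L m = L' m := by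
  have hn0 : n ≠ 0 := by
    have : 0 < n := by nlinarith
    exact this.ne'
  have huu := uPoint_dist_uPoint hn hk (hL 1) (hL' 1) (hL 2) (hL' 2)
  have hvv := vPoint_dist_vPoint hn hk (hL 0) (hL' 0) (hL 2) (hL' 2)
  have hww := wPoint_dist_wPoint hn hk (hL 1) (hL' 1) (hL 0) (hL' 0)
  have huv := uPoint_dist_vPoint hn0 (L 1) (L 2) (L' 0) (L' 2)
  have hvu := uPoint_dist_vPoint hn0 (L' 1) (L' 2) (L 0) (L 2)
  have huw := uPoint_dist_wPoint hn hk (L' 0) (hL 1) (hL' 1) (hL 2)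
  have hwu := uPoint_dist_wPoint hn hk (L 0) (hL' 1) (hL 1) (hL' 2)
  have hvw := vPoint_dist_wPoint hn hk (L' 1) (hL 0) (hL' 0) (hL 2)
  have hwv := vPoint_dist_wPoint hn hk (L 1) (hL' 0) (hL 0) (hL' 2)
  rw [dist_comm] at hvu hwu hwv
  fin_cases t <;> fin_cases t' <;>
    simp [clusterPoint, Fin.forall_fin_succ, huu, hvv, hww, huv, hvu, huw, hwu, hvw, hwv, eq_comm]

/-- Points of the clusters are determined by their color and labels. -/
lemma clusterPoint_eq (hn : 3 * k ^ 2 ≤ n) (hk : 7 ≤ k) {L L' : Fin 3 → ℕ}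
    (hL : ∀ m, L m ∈ Finset.Icc 1 k) (hL' : ∀ m, L' m ∈ Finset.Icc 1 k) {t t' : Fin 3}
    (h : clusterPoint n t L = clusterPoint n t' L') : t = t' ∧ ∀ m, m ≠ t → L m = L' m := by
  -- Equal points have equal neighborhoods, so color and labels can be recovered by probing with
  -- suitable third points instead of comparing coordinates.
  have key : ∀ M : Fin 3 → ℕ, (∀ m, M m ∈ Finset.Icc 1 k) → ∀ s : Fin 3,
      ((t = s ∨ ∀ m, m ≠ t → m ≠ s → L m = M m) ↔
        (t' = s ∨ ∀ m, m ≠ t' → m ≠ s → L' m = M m)) := by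
    intro M hM s
    rw [← clusterPoint_dist_le_one_iff hn hk hL hM, ← clusterPoint_dist_le_one_iff hn hk hL' hM, h]
  have htt' : t = t' := by
    by_contra hne
    have aux : ∀ t t' : Fin 3, t ≠ t' → ∃ s, s ≠ t ∧ s ≠ t' := by decide
    obtain ⟨s, hst, hst'⟩ := aux t t' hne
    -- A probe of color `t'` with all labels `x` is adjacent to the second point, but not to the
    -- first if `t ≠ t'`.
    obtain ⟨x, hx, hxL⟩ : ∃ x ∈ Finset.Icc 1 k, x ≠ L s := by
      by_cases h1 : L s = 1
      · exact ⟨2, by rw [Finset.mem_Icc]; omega, by omega⟩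
      · exact ⟨1, by rw [Finset.mem_Icc]; omega, fun h => h1 h.symm⟩
    have h2 := ((key (fun _ => x) (fun _ => hx) t').2 (Or.inl rfl)).resolve_left hne s hst hst'
    exact hxL h2.symm
  subst htt'
  refine ⟨rfl, fun m hm => ?_⟩
  have aux : ∀ t m : Fin 3, m ≠ t → ∃ s, s ≠ t ∧ m ≠ s := by decide
  obtain ⟨s, hst, hms⟩ := aux t m hm
  exact (((key L hL s).1 (Or.inr fun _ _ _ => rfl)).resolve_left hst.symm m hm hms).symm

end Distances

/-! ### Links and induced matchings -/

section Matchings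

variable {V : Type*} {k : ℕ} {K : AbstractSimplicialComplex V}

namespace TubeComplex

variable (X : TubeComplex K k)

lemma pair_mem_iff [DecidableEq V] {u v : V} (hu : X.color u = 0) (hv : X.color v = 1) :
    {u, v} ∈ K ↔ X.label u 2 = X.label v 2 := by
  rw [X.mem_iff]
  simp only [Finset.insert_nonempty, Finset.mem_insert, Finset.mem_singleton, forall_eq_or_imp,
    forall_eq, hu, hv, true_and]
  simp [Fin.forall_fin_succ, eq_comm]

lemma link_mem_iff [DecidableEq V] {u v w : V} (hu : X.color u = 0) (hv : X.color v = 1)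
    (hw : X.color w = 2) : {u, v} ∈ faceLink K {w} ↔
      X.label u 2 = X.label v 2 ∧ X.label u 1 = X.label w 1 ∧ X.label v 0 = X.label w 0 := by
  have huw : u ≠ w := by
    rintro rfl
    rw [hu] at hw
    exact absurd hw (by decide)
  have hvw : v ≠ w := by
    rintro rfl
    rw [hv] at hw
    exact absurd hw (by decide)
  change ({u, v} : Finset V).Nonempty ∧ {u, v} ∪ {w} ∈ K ∧ Disjoint {u, v} {w} ↔ _
  rw [X.mem_iff]
  simp only [Finset.insert_nonempty, Finset.disjoint_singleton_right, Finset.mem_union,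
    Finset.mem_insert, Finset.mem_singleton, huw.symm, hvw.symm, or_self, not_false_eq_true,
    and_true, true_and, forall_eq, or_imp, forall_and]
  simp [hu, hv, hw, Fin.forall_fin_succ, eq_comm]
  tauto

/-- The pairs of vertices of colors `0` and `1` that form a rainbow triangle with `w`. -/
def linkPairs (w : V) : Set (V × V) :=
  {e | X.color e.1 = 0 ∧ X.color e.2 = 1 ∧ X.label e.1 2 = X.label e.2 2 ∧
    X.label e.1 1 = X.label w 1 ∧ X.label e.2 0 = X.label w 0}

lemma linkPairs_eq {w : V} {e e' : V × V} (he : e ∈ X.linkPairs w) (he' : e' ∈ X.linkPairs w)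
    (h : X.label e.1 2 = X.label e'.1 2) : e = e' := by
  obtain ⟨h1, h2, h3, h4, h5⟩ := he
  obtain ⟨g1, g2, g3, g4, g5⟩ := he'
  refine Prod.ext (X.eq_of_label _ _ (h1.trans g1.symm) ?_)
    (X.eq_of_label _ _ (h2.trans g2.symm) ?_)
  · rw [h1]
    simp [Fin.forall_fin_succ, h, h4, g4]
  · rw [h2]
    simp [Fin.forall_fin_succ, ← h3, ← g3, h, h5, g5]

/-- By `linkPairs_eq`, an edge in the link is determined by the label for color 2 shared by its
ends. A common endpoint or a cross edge would equate these labels for two distinct edges. -/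
lemma isInducedMatching_linkPairs {G : V → V → Prop}
    (hG : ∀ u v, G u v ↔ X.color u = 0 ∧ X.color v = 1 ∧ X.label u 2 = X.label v 2) (w : V) :
    IsInducedMatching G (X.linkPairs w) := by
  refine ⟨fun e he => (hG _ _).2 ⟨he.1, he.2.1, he.2.2.1⟩, fun e he e' he' hne => ?_⟩
  have h : X.label e.1 2 ≠ X.label e'.1 2 := fun h => hne (X.linkPairs_eq he he' h)
  refine ⟨fun h' => h (by rw [h']), fun h' => h ?_, fun h' => h ?_, fun h' => h ?_⟩
  · rw [he.2.2.1, he'.2.2.1, h']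
  · rw [((hG _ _).1 h').2.2, he'.2.2.1]
  · rw [((hG _ _).1 h').2.2, he.2.2.1]

lemma ncard_linkPairs (w : V) : (X.linkPairs w).ncard = k := by
  let L : Fin k → Fin 3 → Fin k := fun l => ![X.label w 0, X.label w 1, l]
  let f : Fin k → V × V := fun l => (X.pt 0 (L l), X.pt 1 (L l))
  have hmem : ∀ l, f l ∈ X.linkPairs w := fun l =>
    ⟨X.color_pt _ _, X.color_pt _ _,
      (X.label_pt 0 (L l) 2 (by decide)).trans (X.label_pt 1 (L l) 2 (by decide)).symm,
      X.label_pt 0 (L l) 1 (by decide), X.label_pt 1 (L l) 0 (by decide)⟩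
  have hlabel : ∀ l, X.label (f l).1 2 = l := fun l => X.label_pt 0 (L l) 2 (by decide)
  have hinj : Function.Injective f := fun l l' h => by rw [← hlabel l, h, hlabel]
  have hrange : X.linkPairs w = f '' Set.univ := by
    refine Set.Subset.antisymm (fun e he => ⟨X.label e.1 2, trivial, ?_⟩) ?_
    · exact X.linkPairs_eq (hmem _) he (hlabel _)
    · rintro _ ⟨l, -, rfl⟩
      exact hmem l
  rw [hrange, Set.ncard_image_of_injective _ hinj, Set.ncard_univ, Nat.card_fin]

/-- Any single edge in the link of `w` reveals both labels of `w`. -/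
lemma disjoint_linkPairs {w w' : V} (hw : X.color w = 2) (hw' : X.color w' = 2) (h : w ≠ w') :
    Disjoint (X.linkPairs w) (X.linkPairs w') := by
  refine Set.disjoint_left.2 fun e he he' => h (X.eq_of_label _ _ (hw.trans hw'.symm) ?_)
  rw [hw]
  simp [Fin.forall_fin_succ, ← he.2.2.2.1, ← he.2.2.2.2, ← he'.2.2.2.1, ← he'.2.2.2.2]

end TubeComplex

end Matchings

/-! ### The configuration as a tube complex -/

section Configuration

variable {n : ℕ}

lemma mem_ripsComplex_iff {d : ℕ} {S : Finset (EuclideanSpace ℝ (Fin d))} (F : Finset S) :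
    F ∈ ripsComplex S ↔ F.Nonempty ∧ ∀ x ∈ F, ∀ y ∈ F, dist x.1 y.1 ≤ 1 := by
  change F.Nonempty ∧ Metric.diam (F : Set S) ≤ 1 ↔ _
  refine and_congr_right fun _ => ⟨fun h x hx y hy => ?_, fun h => ?_⟩
  · exact (Metric.dist_le_diam_of_mem F.finite_toSet.isBounded hx hy).trans h
  · exact Metric.diam_le_of_forall_dist_le zero_le_one h

lemma three_mul_clusterSize_sq_le (n : ℕ) : 3 * clusterSize n ^ 2 ≤ n := by
  have := Nat.sqrt_le' (n / 3)
  rw [clusterSize]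
  omega

lemma lt_three_mul_clusterSize_add_one_sq (n : ℕ) : n < 3 * (clusterSize n + 1) ^ 2 := by
  have := Nat.lt_succ_sqrt' (n / 3)
  rw [Nat.succ_eq_add_one] at this
  rw [clusterSize]
  omega

lemma card_threeClusters_le (n : ℕ) : (threeClusters n).card ≤ n := by
  classical
  have h : ∀ f, (cluster n f).card ≤ clusterSize n ^ 2 := fun f =>
    Finset.card_image_le.trans (by simp [sq])
  have h1 : (threeClusters n).card ≤ _ := Finset.card_union_le _ _
  have h2 : (clusterU n ∪ clusterV n).card ≤ _ := Finset.card_union_le _ _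
  have hU := h (uPoint n)
  have hV := h (vPoint n)
  have hW := h (wPoint n)
  have := three_mul_clusterSize_sq_le n
  unfold clusterU clusterV clusterW at *
  convert! h1.trans ((add_le_add (h2.trans (add_le_add hU hV)) hW).trans _)
  omega

/-- The point of color `t` with labels `L`. -/
noncomputable def labelPoint (n : ℕ) (t : Fin 3) (L : Fin 3 → Fin (clusterSize n)) :
    EuclideanSpace ℝ (Fin 5) :=
  clusterPoint n t fun m => L m + 1

lemma succ_mem_Icc {k : ℕ} (L : Fin 3 → Fin k) (m : Fin 3) :
    (L m : ℕ) + 1 ∈ Finset.Icc 1 k := by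
  have := (L m).2
  rw [Finset.mem_Icc]
  omega

lemma labelPoint_dist_le_one_iff (hk : 7 ≤ clusterSize n) (t t' : Fin 3)
    (L L' : Fin 3 → Fin (clusterSize n)) :
    dist (labelPoint n t L) (labelPoint n t' L') ≤ 1 ↔
      t = t' ∨ ∀ m, m ≠ t → m ≠ t' → L m = L' m := by
  have := clusterPoint_dist_le_one_iff (three_mul_clusterSize_sq_le n) hk (succ_mem_Icc L)
    (succ_mem_Icc L') t t'
  simpa [labelPoint, Fin.val_inj] using this

lemma labelPoint_eq (hk : 7 ≤ clusterSize n) {t t' : Fin 3}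
    {L L' : Fin 3 → Fin (clusterSize n)} (h : labelPoint n t L = labelPoint n t' L') :
    t = t' ∧ ∀ m, m ≠ t → L m = L' m := by
  have := clusterPoint_eq (three_mul_clusterSize_sq_le n) hk (succ_mem_Icc L) (succ_mem_Icc L') h
  simpa [Fin.val_inj] using this

lemma labelPoint_congr {t t' : Fin 3} {L L' : Fin 3 → Fin (clusterSize n)} (ht : t = t')
    (hL : ∀ m, m ≠ t → L m = L' m) : labelPoint n t L = labelPoint n t' L' := by
  subst ht
  unfold labelPoint clusterPoint
  fin_cases t <;> simp [Fin.forall_fin_succ] at hL <;> simp [hL]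

lemma exists_fin_of_mem_Icc {k i : ℕ} (hi : i ∈ Finset.Icc 1 k) : ∃ a : Fin k, (a : ℕ) + 1 = i := by
  rw [Finset.mem_Icc] at hi
  exact ⟨⟨i - 1, by omega⟩, by simp only; omega⟩

lemma mem_cluster_iff {f : ℕ → ℕ → EuclideanSpace ℝ (Fin 5)} {x : EuclideanSpace ℝ (Fin 5)} :
    x ∈ cluster n f ↔ ∃ a b : Fin (clusterSize n), f (a + 1) (b + 1) = x := by
  simp only [cluster, Finset.mem_image, Finset.mem_product, Prod.exists]
  constructor
  · rintro ⟨i, j, ⟨hi, hj⟩, rfl⟩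
    obtain ⟨a, rfl⟩ := exists_fin_of_mem_Icc hi
    obtain ⟨b, rfl⟩ := exists_fin_of_mem_Icc hj
    exact ⟨a, b, rfl⟩
  · rintro ⟨a, b, rfl⟩
    exact ⟨_, _, ⟨succ_mem_Icc (fun _ => a) 0, succ_mem_Icc (fun _ => b) 0⟩, rfl⟩

lemma mem_clusterU_iff {x : EuclideanSpace ℝ (Fin 5)} :
    x ∈ clusterU n ↔ ∃ L, labelPoint n 0 L = x :=
  mem_cluster_iff.trans
    -- The entry of the label vector at the point's own color is a filler that the point ignores.
    ⟨fun ⟨a, b, h⟩ => ⟨![a, a, b], h⟩, fun ⟨L, h⟩ => ⟨L 1, L 2, h⟩⟩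

lemma mem_clusterV_iff {x : EuclideanSpace ℝ (Fin 5)} :
    x ∈ clusterV n ↔ ∃ L, labelPoint n 1 L = x :=
  mem_cluster_iff.trans
    ⟨fun ⟨a, b, h⟩ => ⟨![a, a, b], h⟩, fun ⟨L, h⟩ => ⟨L 0, L 2, h⟩⟩

lemma mem_clusterW_iff {x : EuclideanSpace ℝ (Fin 5)} :
    x ∈ clusterW n ↔ ∃ L, labelPoint n 2 L = x :=
  mem_cluster_iff.trans
    ⟨fun ⟨a, b, h⟩ => ⟨![b, a, a], h⟩, fun ⟨L, h⟩ => ⟨L 1, L 0, h⟩⟩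

lemma mem_threeClusters_iff {x : EuclideanSpace ℝ (Fin 5)} :
    x ∈ threeClusters n ↔ ∃ t L, labelPoint n t L = x := by
  simp only [threeClusters, Finset.mem_union, mem_clusterU_iff, mem_clusterV_iff,
    mem_clusterW_iff, Fin.exists_fin_succ]
  simp [or_assoc]

/-- The Rips complex of the configuration as a complex of three clusters joined by tubes. -/
noncomputable def ripsTubeComplex (hk : 7 ≤ clusterSize n) :
    TubeComplex (ripsComplex (threeClusters n)) (clusterSize n) where
  color x := (mem_threeClusters_iff.1 x.2).choose
  label x := (mem_threeClusters_iff.1 x.2).choose_spec.choose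
  mem_iff F := by
    rw [mem_ripsComplex_iff]
    refine and_congr_right fun _ => forall₂_congr fun x _ => forall₂_congr fun y _ => ?_
    rw [← labelPoint_dist_le_one_iff hk, (mem_threeClusters_iff.1 x.2).choose_spec.choose_spec,
      (mem_threeClusters_iff.1 y.2).choose_spec.choose_spec]
  eq_of_label x y h1 h2 := by
    exact Subtype.ext ((mem_threeClusters_iff.1 x.2).choose_spec.choose_spec.symm.trans
      ((labelPoint_congr h1 h2).trans (mem_threeClusters_iff.1 y.2).choose_spec.choose_spec))
  pt t L := ⟨labelPoint n t L, mem_threeClusters_iff.2 ⟨t, L, rfl⟩⟩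
  -- Color and labels were picked by choice; `labelPoint_eq` shows that the choice is forced, except
  -- for the filler label.
  color_pt t L :=
    (labelPoint_eq hk (mem_threeClusters_iff.1 (mem_threeClusters_iff.2
      ⟨t, L, rfl⟩)).choose_spec.choose_spec).1
  label_pt t L m hm :=
    ((labelPoint_eq hk (mem_threeClusters_iff.1 (mem_threeClusters_iff.2
      ⟨t, L, rfl⟩)).choose_spec.choose_spec.symm).2 m hm).symm

lemma labelPoint_color_label (hk : 7 ≤ clusterSize n) (x : threeClusters n) :
    labelPoint n ((ripsTubeComplex hk).color x) ((ripsTubeComplex hk).label x) = x :=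
  (mem_threeClusters_iff.1 x.2).choose_spec.choose_spec

lemma color_eq_iff (hk : 7 ≤ clusterSize n) (x : threeClusters n) (t : Fin 3) :
    (∃ L, labelPoint n t L = x.1) ↔ (ripsTubeComplex hk).color x = t := by
  constructor
  · rintro ⟨L, h⟩
    exact (labelPoint_eq hk ((labelPoint_color_label hk x).trans h.symm)).1
  · rintro rfl
    exact ⟨_, labelPoint_color_label hk x⟩

lemma crossEdge_iff (hk : 7 ≤ clusterSize n) (u v : threeClusters n) :
    crossEdge n u v ↔ (ripsTubeComplex hk).color u = 0 ∧ (ripsTubeComplex hk).color v = 1 ∧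
      (ripsTubeComplex hk).label u 2 = (ripsTubeComplex hk).label v 2 := by
  rw [crossEdge, mem_clusterU_iff, mem_clusterV_iff, color_eq_iff hk, color_eq_iff hk]
  exact and_congr_right fun hu => and_congr_right fun hv =>
    (ripsTubeComplex hk).pair_mem_iff hu hv

lemma linkCrossEdges_eq (hk : 7 ≤ clusterSize n) {w : threeClusters n} (hw : w.1 ∈ clusterW n) :
    linkCrossEdges n w = (ripsTubeComplex hk).linkPairs w := by
  rw [mem_clusterW_iff, color_eq_iff hk] at hw
  ext e
  change e.1.1 ∈ clusterU n ∧ e.2.1 ∈ clusterV n ∧ _ ↔ _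
  rw [mem_clusterU_iff, mem_clusterV_iff, color_eq_iff hk, color_eq_iff hk]
  exact and_congr_right fun hu => and_congr_right fun hv =>
    (ripsTubeComplex hk).link_mem_iff hu hv hw

end Configuration

/-! ### Asymptotics -/

section Asymptotics

open Asymptotics

lemma abs_clusterSize_sub_sqrt_le (n : ℕ) : |(clusterSize n : ℝ) - √((n : ℝ) / 3)| ≤ 1 := by
  have h1 : 3 * (clusterSize n : ℝ) ^ 2 ≤ n := by exact_mod_cast three_mul_clusterSize_sq_le n
  have h2 : (n : ℝ) < 3 * (clusterSize n + 1 : ℝ) ^ 2 := by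
    exact_mod_cast lt_three_mul_clusterSize_add_one_sq n
  have h3 : (clusterSize n : ℝ) ≤ √((n : ℝ) / 3) := Real.le_sqrt_of_sq_le (by linarith)
  have h4 : √((n : ℝ) / 3) ≤ clusterSize n + 1 :=
    (Real.sqrt_le_left (by positivity)).2 (by linarith)
  exact abs_le.2 ⟨by linarith, by linarith⟩

lemma tendsto_sqrt_div_three : Tendsto (fun n : ℕ => √((n : ℝ) / 3)) atTop atTop :=
  Real.tendsto_sqrt_atTop.comp
    (tendsto_natCast_atTop_atTop.atTop_div_const (by norm_num))

lemma clusterSize_isEquivalent :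
    (fun n : ℕ => (clusterSize n : ℝ)) ~[atTop] fun n : ℕ => √((n : ℝ) / 3) := by
  have h1 : ((fun n : ℕ => (clusterSize n : ℝ)) - fun n : ℕ => √((n : ℝ) / 3)) =O[atTop]
      (fun _ => (1 : ℝ)) :=
    IsBigO.of_bound 1 (Eventually.of_forall fun n => by
      simpa using abs_clusterSize_sub_sqrt_le n)
  exact h1.trans_isLittleO ((isLittleO_const_left_of_ne one_ne_zero).2
    (tendsto_norm_atTop_atTop.comp tendsto_sqrt_div_three))

lemma tendsto_clusterSize : Tendsto clusterSize atTop atTop :=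
  tendsto_natCast_atTop_iff.1 (clusterSize_isEquivalent.symm.tendsto_atTop tendsto_sqrt_div_three)

lemma sqrt_div_three_pow (n : ℕ) :
    √((n : ℝ) / 3) ^ 3 = (3 : ℝ) ^ (-(3 / 2) : ℝ) * (n : ℝ) ^ (3 / 2 : ℝ) := by
  rw [Real.sqrt_eq_rpow, ← Real.rpow_natCast, ← Real.rpow_mul (by positivity),
    Real.div_rpow (by positivity) (by positivity), Real.rpow_neg (by positivity)]
  norm_num
  ring

lemma reducedBetti_isEquivalent (𝕜 : Type*) [Field 𝕜] :
    (fun n : ℕ => (reducedBetti 𝕜 (ripsComplex (threeClusters n)) 2 : ℝ)) ~[atTop]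
      fun n : ℕ => (clusterSize n : ℝ) ^ 3 := by
  have h1 : ((fun n : ℕ => (reducedBetti 𝕜 (ripsComplex (threeClusters n)) 2 : ℝ)) -
      fun n : ℕ => (clusterSize n : ℝ) ^ 3) =O[atTop] fun n : ℕ => (clusterSize n : ℝ) := by
    refine IsBigO.of_bound 3 ?_
    filter_upwards [tendsto_clusterSize.eventually_ge_atTop 7] with n hk
    have h1 : (reducedBetti 𝕜 (ripsComplex (threeClusters n)) 2 : ℝ) ≤ (clusterSize n : ℝ) ^ 3 := by
      exact_mod_cast (ripsTubeComplex hk).reducedBetti_le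
    have h2 : (clusterSize n : ℝ) ^ 3 ≤
        (reducedBetti 𝕜 (ripsComplex (threeClusters n)) 2 : ℝ) + 3 * clusterSize n := by
      exact_mod_cast (ripsTubeComplex hk).le_reducedBetti
    rw [Pi.sub_apply, Real.norm_eq_abs, Real.norm_eq_abs, Nat.abs_cast]
    exact abs_le.2 ⟨by linarith, by linarith [Nat.cast_nonneg (α := ℝ) (clusterSize n)]⟩
  have h2 : (fun x : ℝ => x) =o[atTop] fun x : ℝ => x ^ 3 := by
    simpa using isLittleO_pow_pow_atTop_of_lt (𝕜 := ℝ) (p := 1) (q := 3) (by norm_num)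
  exact h1.trans_isLittleO
    (h2.comp_tendsto (tendsto_natCast_atTop_atTop.comp tendsto_clusterSize))

/-- For `k ≥ 7`, `n < 3 * (k + 1) ^ 2 ≤ 9 * k ^ 2` gives `n ^ (3 / 2) ≤ 27 * k ^ 3`, while `k ^ 3 -
3 * k ≥ (46 / 49) * k ^ 3`. The constant 1/128 leaves ample room. -/
lemma lt_maxRipsBetti (𝕜 : Type*) [Field 𝕜] {n : ℕ} (hk : 7 ≤ clusterSize n) :
    1 / 128 * (n : ℝ) ^ (3 / 2 : ℝ) < (maxRipsBetti 𝕜 2 5 n : ℝ) := by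
  have h1 : (clusterSize n : ℝ) ^ 3 ≤
      (reducedBetti 𝕜 (ripsComplex (threeClusters n)) 2 : ℝ) + 3 * clusterSize n := by
    exact_mod_cast (ripsTubeComplex hk).le_reducedBetti
  have h2 : (reducedBetti 𝕜 (ripsComplex (threeClusters n)) 2 : ℝ) ≤ maxRipsBetti 𝕜 2 5 n := by
    exact_mod_cast (isGreatest_maxRipsBetti 𝕜 2 5 n).2
      ⟨threeClusters n, card_threeClusters_le n, rfl⟩
  have hk' : (7 : ℝ) ≤ clusterSize n := by exact_mod_cast hk
  have h3 : (n : ℝ) < 3 * (clusterSize n + 1 : ℝ) ^ 2 := by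
    exact_mod_cast lt_three_mul_clusterSize_add_one_sq n
  have h4 : √(n : ℝ) ≤ 3 * clusterSize n := by
    refine (Real.sqrt_le_left (by positivity)).2 ?_
    nlinarith
  have h5 : (n : ℝ) ^ (3 / 2 : ℝ) ≤ (3 * clusterSize n) ^ 3 := by
    refine le_trans (le_of_eq ?_) (pow_le_pow_left₀ (Real.sqrt_nonneg _) h4 3)
    rw [Real.sqrt_eq_rpow, ← Real.rpow_natCast, ← Real.rpow_mul (by positivity)]
    norm_num
  nlinarith [mul_nonneg (sub_nonneg.2 hk') (sq_nonneg (clusterSize n : ℝ))]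

end Asymptotics

theorem mainTheorem4 :
    (∃ C : ℝ, 0 < C ∧ ∀ᶠ n : ℕ in atTop, ∀ (𝕜 : Type*) [Field 𝕜],
      C * (n : ℝ) ^ (3 / 2 : ℝ) < (maxRipsBetti 𝕜 2 5 n : ℝ)) ∧
    (∀ᶠ n : ℕ in atTop,
      (threeClusters n).card ≤ n ∧
      (∀ w : threeClusters n, w.1 ∈ clusterW n →
        IsInducedMatching (crossEdge n) (linkCrossEdges n w) ∧
        (linkCrossEdges n w).ncard = clusterSize n) ∧
      (∀ w w' : threeClusters n, w.1 ∈ clusterW n → w'.1 ∈ clusterW n → w ≠ w' →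
        Disjoint (linkCrossEdges n w) (linkCrossEdges n w'))) ∧
    (∀ (𝕜 : Type*) [Field 𝕜],
      Asymptotics.IsEquivalent atTop
        (fun n : ℕ => (reducedBetti 𝕜 (ripsComplex (threeClusters n)) 2 : ℝ))
        (fun n : ℕ => (3 : ℝ) ^ (-(3 / 2) : ℝ) * (n : ℝ) ^ (3 / 2 : ℝ))) := by
  refine ⟨⟨1 / 128, by norm_num, ?_⟩, ?_, fun 𝕜 _ => ?_⟩
  · filter_upwards [tendsto_clusterSize.eventually_ge_atTop 7] with n hk 𝕜 _
    exact lt_maxRipsBetti 𝕜 hk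
  · filter_upwards [tendsto_clusterSize.eventually_ge_atTop 7] with n hk
    refine ⟨card_threeClusters_le n, fun w hw => ?_, fun w w' hw hw' hne => ?_⟩
    · rw [linkCrossEdges_eq hk hw]
      exact ⟨(ripsTubeComplex hk).isInducedMatching_linkPairs (crossEdge_iff hk) w,
        (ripsTubeComplex hk).ncard_linkPairs w⟩
    · rw [linkCrossEdges_eq hk hw, linkCrossEdges_eq hk hw']
      rw [mem_clusterW_iff, color_eq_iff hk] at hw hw'
      exact (ripsTubeComplex hk).disjoint_linkPairs hw hw' hne
  · refine (reducedBetti_isEquivalent 𝕜).trans ?_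
    have h := clusterSize_isEquivalent.pow 3
    refine h.congr_right (Eventually.of_forall fun n => ?_)
    exact sqrt_div_three_pow n
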